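/- Let $\mathcal{P} \subset \mathbb{R}^2$ be a (nondegenerate, closed) parallelogram symmetric about the origin, i.e. $\mathcal{P} = -\mathcal{P}$, and let $N \ge 2$. Let $x_1, \dots, x_N$ be independent random points, each uniformly distributed in $\mathcal{P}$, and set $$V_{\mathcal{P},N} = \frac{\mathrm{vol}_2\big(\mathrm{conv}\{\pm x_1, \pm x_2, \dots, \pm x_N\}\big)}{\mathrm{vol}_2(\mathcal{P})}.$$ Then $$\mathbb{E}\, V_{\mathcal{P},N} = 1 - \frac{4}{3(N+1)} \sum_{k=1}^{N+1} \frac{1}{k}.$$ -/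

import Mathlib

open MeasureTheory ProbabilityTheory
open scoped Pointwise

/-- A (closed, nondegenerate) parallelogram in the plane: the set
`{c + s a + t b : s, t ∈ [0, 1]}` for a point `c` and linearly independent vectors `a`, `b`. -/
def IsParallelogram (P : Set (EuclideanSpace ℝ (Fin 2))) : Prop :=
  ∃ c a b : EuclideanSpace ℝ (Fin 2), LinearIndependent ℝ ![a, b] ∧
    P = {x | ∃ s ∈ Set.Icc (0 : ℝ) 1, ∃ t ∈ Set.Icc (0 : ℝ) 1, x = c + s • a + t • b}

/-- The symmetric convex hull `conv {± x₁, …, ± x_N}` of a finite family of points. -/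
def symmConvexHull {n N : ℕ} (x : Fin N → EuclideanSpace ℝ (Fin n)) :
    Set (EuclideanSpace ℝ (Fin n)) :=
  convexHull ℝ (Set.range x ∪ Set.range (fun i => -x i))

/-- The normalized volume `vol (conv {± x₁, …, ± x_N}) / vol K`. -/
noncomputable def normalizedSymmVolume {n N : ℕ} (K : Set (EuclideanSpace ℝ (Fin n)))
    (x : Fin N → EuclideanSpace ℝ (Fin n)) : ℝ :=
  (volume (symmConvexHull x)).toReal / (volume K).toReal

/-! A linear map carries the parallelogram to the square `[-1, 1]²`, so only uniform points of the
square matter. The expected normalized area of the hull is the probability that a further uniform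
point `z` falls inside it, hence one minus the probability that `z` misses the hull of the other `N
= n + 1` points and their reflections.

If `z` is outside, two tangents to the hull pass through `z`; on a fixed side, the tangent touches
some `± y i`. Equivalently, all `± y j` lie in the strip between the line through `z` and that point
and the reflected line. Some index has this property for the closed strip
(`exists_closedStrip_of_notMem_planarSymmHull`). Conversely, when there are at least two points, the
property for the open strip puts `z` outside (`notMem_planarSymmHull_of_openStrip`), and at most one
index has it (`notMem_openStrip_orient_of_mem`). Open and closed strips have the same area for
almost every pair, so the probability of missing is `n + 1` times the integral of `(strip area) ^ n`
over pairs of points.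

That integral is computed in the coordinates `(c, m)` of the line `u = c + m v` through the pair
(`lintegral_lintegral_line_coordinates`). The positions on the line contribute the cube of the chord
length over 3. Lines joining opposite sides give elementary integrals; lines cutting off a corner
give the harmonic sum. The total is `lintegral_stripArea_pow_mul`, and
`lintegral_compl_planarSymmHull` assembles the probability. -/

/-! ### Points outside a symmetric hull and tangency strips -/

/-- The determinant of two vectors of the plane. -/
def cross (z w : ℝ × ℝ) : ℝ := z.1 * w.2 - z.2 * w.1

/-- The vector `y` or `-y`, chosen so that its determinant with `z` is nonpositive. -/
noncomputable def orient (z y : ℝ × ℝ) : ℝ × ℝ := if 0 < cross z y then -y else y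

/-- The open strip bounded by the line through `z` and `y` and its reflection in the origin. -/
def openStrip (z y : ℝ × ℝ) : Set (ℝ × ℝ) := {w | |cross w (y - z)| < |cross z y|}

/-- The closed strip bounded by the line through `z` and `y` and its reflection in the origin. -/
def closedStrip (z y : ℝ × ℝ) : Set (ℝ × ℝ) := {w | |cross w (y - z)| ≤ |cross z y|}

/-- The convex hull of a family of points of the plane and their reflections in the origin. -/
def planarSymmHull {N : ℕ} (y : Fin N → ℝ × ℝ) : Set (ℝ × ℝ) :=
  convexHull ℝ (Set.range y ∪ Set.range (fun i => -y i))

lemma cross_orient_nonpos (z y : ℝ × ℝ) : cross z (orient z y) ≤ 0 := by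
  unfold orient
  split_ifs with h
  · simp only [cross, Prod.fst_neg, Prod.snd_neg] at *; linarith
  · exact not_lt.mp h

lemma orient_eq_or (z y : ℝ × ℝ) : orient z y = y ∨ orient z y = -y := by
  unfold orient; split_ifs <;> simp

lemma abs_cross_orient_left (z y d : ℝ × ℝ) : |cross (orient z y) d| = |cross y d| := by
  rcases orient_eq_or z y with h | h
  · rw [h]
  · rw [h, ← abs_neg]; congr 1; simp only [cross, Prod.fst_neg, Prod.snd_neg]; ring

/-- Hahn–Banach separation from a compact convex set; since the set contains both `y j` and `-y j`,
the one-sided bound becomes a bound on the absolute value. -/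
lemma exists_linear_of_notMem_planarSymmHull {n : ℕ} {y : Fin (n + 1) → ℝ × ℝ} {z : ℝ × ℝ}
    (hz : z ∉ planarSymmHull y) :
    ∃ p q : ℝ, ∀ j, |p * (y j).1 + q * (y j).2| < p * z.1 + q * z.2 := by
  have hc : IsCompact (planarSymmHull y) :=
    ((Set.finite_range y).union (Set.finite_range _)).isCompact_convexHull ℝ
  obtain ⟨f, u, hf, hu⟩ := geometric_hahn_banach_closed_point (convex_convexHull ℝ _)
    hc.isClosed hz
  have hlin : ∀ w : ℝ × ℝ, f w = f (1, 0) * w.1 + f (0, 1) * w.2 := by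
    intro w
    have : w = w.1 • ((1 : ℝ), (0 : ℝ)) + w.2 • ((0 : ℝ), (1 : ℝ)) := by ext <;> simp
    conv_lhs => rw [this]
    rw [map_add, map_smul, map_smul]; simp only [smul_eq_mul]; ring
  refine ⟨f (1, 0), f (0, 1), fun j => ?_⟩
  rw [← hlin, ← hlin, abs_lt]
  have h1 := hf (y j) (subset_convexHull ℝ _ (Or.inl ⟨j, rfl⟩))
  have h2 := hf (-y j) (subset_convexHull ℝ _ (Or.inr ⟨j, rfl⟩))
  rw [map_neg] at h2
  constructor <;> linarith

lemma notMem_planarSymmHull_of_linear {N : ℕ} {y : Fin N → ℝ × ℝ} {z : ℝ × ℝ} {p q : ℝ}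
    (h : ∀ j, |p * (y j).1 + q * (y j).2| < p * z.1 + q * z.2) : z ∉ planarSymmHull y := by
  intro hz
  have hsub : planarSymmHull y ⊆ {w : ℝ × ℝ | p * w.1 + q * w.2 < p * z.1 + q * z.2} := by
    refine convexHull_min ?_ ?_
    · rintro _ (⟨j, rfl⟩ | ⟨j, rfl⟩)
      · exact (abs_lt.mp (h j)).2
      · have := (abs_lt.mp (h j)).1
        simp only [Set.mem_ofPred_eq, Prod.fst_neg, Prod.snd_neg]; linarith
    · refine convex_halfSpace_lt ⟨fun a b => ?_, fun c a => ?_⟩ _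
      · simp only [Prod.fst_add, Prod.snd_add]; ring
      · simp only [Prod.smul_fst, Prod.smul_snd, smul_eq_mul]; ring
  have h' := hsub hz
  simp only [Set.mem_ofPred_eq, lt_self_iff_false] at h'

/-- Separation writes the set as a union, over all linear functionals, of finite intersections of
open conditions. This supplies the joint measurability needed for Fubini. -/
lemma isOpen_notMem_planarSymmHull (n : ℕ) :
    IsOpen {p : (Fin (n + 1) → ℝ × ℝ) × (ℝ × ℝ) | p.2 ∉ planarSymmHull p.1} := by
  have : {p : (Fin (n + 1) → ℝ × ℝ) × (ℝ × ℝ) | p.2 ∉ planarSymmHull p.1} =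
      ⋃ a : ℝ, ⋃ b : ℝ, ⋂ j, {p | |a * (p.1 j).1 + b * (p.1 j).2| < a * p.2.1 + b * p.2.2} := by
    ext p
    simp only [Set.mem_ofPred_eq, Set.mem_iUnion, Set.mem_iInter]
    exact ⟨exists_linear_of_notMem_planarSymmHull,
      fun ⟨a, b, h⟩ => notMem_planarSymmHull_of_linear h⟩
  rw [this]
  refine isOpen_iUnion fun a => isOpen_iUnion fun b => isOpen_iInter_of_finite fun j => ?_
  exact isOpen_lt (by fun_prop) (by fun_prop)

/-- Of two points, at most one can be the left tangency point. -/
lemma notMem_openStrip_orient_of_mem {z a b : ℝ × ℝ} (h : b ∈ openStrip z (orient z a)) :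
    a ∉ openStrip z (orient z b) := by
  intro h'
  simp only [openStrip, Set.mem_ofPred_eq] at h h'
  rw [← abs_cross_orient_left z b] at h
  rw [← abs_cross_orient_left z a] at h'
  have ha := cross_orient_nonpos z a
  have hb := cross_orient_nonpos z b
  generalize orient z a = A at *
  generalize orient z b = B at *
  rw [abs_of_nonpos ha] at h
  rw [abs_of_nonpos hb] at h'
  have h1 := (abs_lt.mp h).1
  have h2 := (abs_lt.mp h').1
  simp only [cross, Prod.fst_sub, Prod.snd_sub] at *
  linarith

/-- The functional constant on the line through `z` and `A` separates `z` from every `± y j` except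
`± y i`, where it ties. A slight tilt breaks the tie and, by continuity, preserves the other strict
inequalities. -/
lemma notMem_planarSymmHull_of_openStrip {N : ℕ} {y : Fin N → ℝ × ℝ} {z : ℝ × ℝ} {i : Fin N}
    (hi : cross z (y i) ≠ 0)
    (h : ∀ j, j ≠ i → y j ∈ openStrip z (orient z (y i))) : z ∉ planarSymmHull y := by
  set A := orient z (y i) with hA
  have hA0 : cross z A < 0 := by
    refine lt_of_le_of_ne (cross_orient_nonpos z _) ?_
    rcases orient_eq_or z (y i) with h | h <;> rw [hA, h]
    · exact hi
    · intro h0; apply hi; simp only [cross, Prod.fst_neg, Prod.snd_neg] at *; linarith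
  have hev : ∀ᶠ ε in nhdsWithin (0 : ℝ) (Set.Iio 0), ∀ j, j ≠ i →
      |(-cross (y j) (A - z)) + ε * cross (y j) z| < -cross z A := by
    rw [Filter.eventually_all]
    intro j
    by_cases hj : j = i
    · simp [hj]
    · have hlt : |(-cross (y j) (A - z)) + 0 * cross (y j) z| < -cross z A := by
        have := h j hj
        simp only [openStrip, Set.mem_ofPred_eq] at this
        rw [abs_of_neg hA0] at this
        simpa using this
      have hcont : Continuous fun ε : ℝ => |(-cross (y j) (A - z)) + ε * cross (y j) z| := by
        fun_prop
      have := (hcont.tendsto 0).eventually (gt_mem_nhds hlt)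
      filter_upwards [nhdsWithin_le_nhds this] with ε hε _ using hε
  have hev2 : ∀ᶠ ε in nhdsWithin (0 : ℝ) (Set.Iio 0), (-1 : ℝ) < ε :=
    nhdsWithin_le_nhds (lt_mem_nhds (by norm_num))
  obtain ⟨ε, ⟨h1, h2⟩, h3⟩ := ((hev.and hev2).and self_mem_nhdsWithin).exists
  have h3' : ε < 0 := h3
  -- This functional is `w ↦ -cross w (A - z) + ε * cross w z`. It equals `-cross z A` at `z` and
  -- `(1 + ε)` times that at `A`, whence the requirement `-1 < ε < 0`.
  refine notMem_planarSymmHull_of_linear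
    (p := -(A.2 - z.2) + ε * z.2) (q := (A.1 - z.1) - ε * z.1) fun j => ?_
  by_cases hj : j = i
  · subst hj
    have habs : |(-(A.2 - z.2) + ε * z.2) * (y j).1 + ((A.1 - z.1) - ε * z.1) * (y j).2| =
        |(-(A.2 - z.2) + ε * z.2) * A.1 + ((A.1 - z.1) - ε * z.1) * A.2| := by
      rcases orient_eq_or z (y j) with h | h
      · rw [hA, h]
      · have h' : y j = -A := by rw [hA, h, neg_neg]
        rw [h', ← abs_neg]; congr 1; simp only [Prod.fst_neg, Prod.snd_neg]; ring
    rw [habs, abs_lt]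
    simp only [cross] at hA0
    constructor <;> nlinarith
  · have := h1 j hj
    convert this using 2 <;> simp only [cross, Prod.fst_sub, Prod.snd_sub] <;> ring

/-- A separating line through `z` is rotated about `z` until it first touches an oriented point;
that point is the tangency point. -/
lemma exists_closedStrip_of_notMem_planarSymmHull {n : ℕ} {y : Fin (n + 1) → ℝ × ℝ}
    {z : ℝ × ℝ} (hz : z ∉ planarSymmHull y) :
    ∃ i, ∀ j, y j ∈ closedStrip z (orient z (y i)) := by
  obtain ⟨p, q, hpq⟩ := exists_linear_of_notMem_planarSymmHull hz
  set r := p * z.1 + q * z.2 with hr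
  have hr0 : 0 < r := (abs_nonneg _).trans_lt (hpq 0)
  have hB : ∀ j, |p * (orient z (y j)).1 + q * (orient z (y j)).2| < r := by
    intro j
    rcases orient_eq_or z (y j) with h | h <;> rw [h]
    · exact hpq j
    · rw [← abs_neg]; convert hpq j using 2; simp only [Prod.fst_neg, Prod.snd_neg]; ring
  have hmem : ∀ i j, orient z (y j) ∈ closedStrip z (orient z (y i)) →
      y j ∈ closedStrip z (orient z (y i)) := by
    intro i j h
    simp only [closedStrip, Set.mem_ofPred_eq] at *
    rwa [abs_cross_orient_left] at h
  have hb : ∀ j, cross z (orient z (y j)) ≤ 0 := fun j => cross_orient_nonpos z _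
  suffices h : ∃ i, ∀ j, orient z (y j) ∈ closedStrip z (orient z (y i)) by
    obtain ⟨i, hi⟩ := h
    exact ⟨i, fun j => hmem i j (hi j)⟩
  generalize hBdef : (fun j => orient z (y j)) = B at *
  have hB' : ∀ j, orient z (y j) = B j := fun j => congrFun hBdef j
  simp only [hB'] at *
  -- The linear relation between the three plane vectors `z`, `w`, `a`, evaluated by the separating
  -- functional.
  have hcramer : ∀ a w : ℝ × ℝ, r * cross w a =
      (p * w.1 + q * w.2) * cross z a - (p * a.1 + q * a.2) * cross z w := by
    intro a w; rw [hr]; simp only [cross]; ring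
  -- In the degenerate case all points lie on the line through `z` and the origin, and any index
  -- works.
  by_cases hall : ∀ j, cross z (B j) = 0
  · refine ⟨0, fun j => ?_⟩
    simp only [closedStrip, Set.mem_ofPred_eq, hall 0, abs_zero]
    have h1 := hcramer (B 0) (B j)
    rw [hall, hall, mul_zero, mul_zero, sub_zero] at h1
    have h2 := (mul_eq_zero.mp h1).resolve_left hr0.ne'
    have h3 := hall j
    rw [show cross (B j) (B 0 - z) = cross (B j) (B 0) + cross z (B j) by
      simp only [cross, Prod.fst_sub, Prod.snd_sub]; ring, h2, h3]
    simp
  · push Not at hall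
    obtain ⟨i₀, hi₀⟩ := hall
    obtain ⟨i, hi, hmin⟩ := Finset.exists_min_image
      (Finset.univ.filter fun j => cross z (B j) ≠ 0)
      (fun j => (r - (p * (B j).1 + q * (B j).2)) / (-cross z (B j))) ⟨i₀, by simpa using hi₀⟩
    simp only [Finset.mem_filter, Finset.mem_univ, true_and] at hi hmin
    have hbi : 0 < -cross z (B i) := by
      have := lt_of_le_of_ne (hb i) hi; linarith
    -- Adding `τ * (-cross z ·)` to the functional keeps the value `r` at `z`. The least admissible
    -- ratio `τ` is the amount of rotation at which the first oriented point, `B i`, also reaches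
    -- `r`.
    set τ := (r - (p * (B i).1 + q * (B i).2)) / (-cross z (B i)) with hτ
    have hτi : τ * (-cross z (B i)) = r - (p * (B i).1 + q * (B i).2) :=
      div_mul_cancel₀ _ hbi.ne'
    have hτ0 : 0 < τ := div_pos (by have := (abs_lt.mp (hB i)).2; linarith) hbi
    have key : ∀ j, |p * (B j).1 + q * (B j).2 + τ * (-cross z (B j))| ≤ r := by
      intro j
      obtain ⟨h1, h2⟩ := abs_lt.mp (hB j)
      by_cases hj : cross z (B j) = 0
      · rw [hj, abs_le]; constructor <;> linarith
      · have hbj : 0 < -cross z (B j) := by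
          have := lt_of_le_of_ne (hb j) hj; linarith
        have h3 := (le_div_iff₀ hbj).mp (hmin j hj)
        have := mul_pos hτ0 hbj
        rw [abs_le]; constructor <;> linarith
    refine ⟨i, fun j => ?_⟩
    simp only [closedStrip, Set.mem_ofPred_eq]
    rw [abs_of_neg (a := cross z (B i)) (by linarith)]
    refine le_of_mul_le_mul_left ?_ hr0
    have hid : r * cross (B j) (B i - z) =
        -((p * (B j).1 + q * (B j).2 + τ * (-cross z (B j))) * (-cross z (B i))) := by
      have h1 := hcramer (B i) (B j)
      rw [show cross (B j) (B i - z) = cross (B j) (B i) + cross z (B j) by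
        simp only [cross, Prod.fst_sub, Prod.snd_sub]; ring]
      linear_combination h1 - cross z (B j) * hτi
    rw [← abs_of_pos hr0, ← abs_mul, hid, abs_neg, abs_mul, abs_of_pos hbi, abs_of_pos hr0]
    exact mul_le_mul_of_nonneg_right (key j) hbi.le

/-! ### Integration over pairs of points through the lines joining them -/

lemma lintegral_eq_mul_lintegral_comp_affine {f : ℝ → ENNReal} (hf : Measurable f) {a : ℝ}
    (ha : a ≠ 0) (b : ℝ) :
    ∫⁻ x, f x = ENNReal.ofReal |a| * ∫⁻ x, f (b + a * x) := by
  calc ∫⁻ x, f x = ∫⁻ x, f (b + x) := (lintegral_add_left_eq_self f b).symm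
    _ = ∫⁻ x, f (b + x) ∂(ENNReal.ofReal |a| • Measure.map (fun x => a * x) volume) := by
        rw [Real.smul_map_volume_mul_left ha]
    _ = _ := by
        rw [lintegral_smul_measure, lintegral_map (by fun_prop) (by fun_prop), smul_eq_mul]

lemma lintegral_eq_two_mul_of_even {f : ℝ → ENNReal} (hf : ∀ x, f (-x) = f x) :
    ∫⁻ x, f x = 2 * ∫⁻ x in Set.Ioi 0, f x := by
  have h : ∫⁻ x in Set.Iic 0, f x = ∫⁻ x in Set.Ioi 0, f x := by
    rw [← lintegral_indicator measurableSet_Iic, ← lintegral_neg_eq_self,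
      ← setLIntegral_congr (Ioi_ae_eq_Ici (a := (0 : ℝ))).symm,
      ← lintegral_indicator measurableSet_Ici]
    refine lintegral_congr fun x => ?_
    simp only [Set.indicator_apply, Set.mem_Iic, Left.neg_nonpos_iff, Set.mem_Ici, hf]
  rw [← lintegral_add_compl f (measurableSet_Ioi (a := (0 : ℝ))), Set.compl_Ioi, h, two_mul]

lemma lintegral_Ioc_ofReal_eq_sub {g G : ℝ → ℝ} {a b : ℝ} (hab : a ≤ b)
    (hG : ∀ x ∈ Set.Icc a b, HasDerivAt G (g x) x) (hg : ContinuousOn g (Set.Icc a b))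
    (hpos : ∀ x ∈ Set.Icc a b, 0 ≤ g x) :
    ∫⁻ x in Set.Ioc a b, ENNReal.ofReal (g x) = ENNReal.ofReal (G b - G a) := by
  have hint : IntervalIntegrable g volume a b :=
    ContinuousOn.intervalIntegrable (by rwa [Set.uIcc_of_le hab])
  rw [← intervalIntegral.integral_eq_sub_of_hasDerivAt (by rwa [Set.uIcc_of_le hab]) hint,
    intervalIntegral.integral_of_le hab, ofReal_integral_eq_lintegral_ofReal hint.1]
  filter_upwards [ae_restrict_mem measurableSet_Ioc] with x hx
  exact hpos x ⟨hx.1.le, hx.2⟩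

/-- With `v₁`, `v₂` fixed, the slope replaces `u₂` by `u₂ = u₁ + (v₂ - v₁) m`, which yields the
Jacobian; then `u₁ = c + m v₁` is a translation. -/
lemma lintegral_line_coordinates {h : ℝ → ℝ → ENNReal} (hh : Measurable (Function.uncurry h))
    {v₁ v₂ : ℝ} (hv : v₁ ≠ v₂) :
    ∫⁻ u₁, ∫⁻ u₂, h u₁ u₂ =
      ENNReal.ofReal |v₂ - v₁| * ∫⁻ c, ∫⁻ m, h (c + m * v₁) (c + m * v₂) := by
  have hd : v₂ - v₁ ≠ 0 := sub_ne_zero.mpr hv.symm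
  calc ∫⁻ u₁, ∫⁻ u₂, h u₁ u₂
      = ∫⁻ u₁, ENNReal.ofReal |v₂ - v₁| * ∫⁻ m, h u₁ (u₁ + (v₂ - v₁) * m) :=
        lintegral_congr fun u₁ => lintegral_eq_mul_lintegral_comp_affine (by fun_prop) hd u₁
    _ = ENNReal.ofReal |v₂ - v₁| * ∫⁻ u₁, ∫⁻ m, h u₁ (u₁ + (v₂ - v₁) * m) :=
        lintegral_const_mul' _ _ ENNReal.ofReal_ne_top
    _ = ENNReal.ofReal |v₂ - v₁| * ∫⁻ m, ∫⁻ u₁, h u₁ (u₁ + (v₂ - v₁) * m) := by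
        rw [lintegral_lintegral_swap]
        exact Measurable.aemeasurable (hh.comp (g := Function.uncurry h)
          (f := fun p : ℝ × ℝ => (p.1, p.1 + (v₂ - v₁) * p.2)) (by fun_prop))
    _ = ENNReal.ofReal |v₂ - v₁| * ∫⁻ m, ∫⁻ c, h (c + m * v₁) (c + m * v₂) := by
        congr 1
        refine lintegral_congr fun m => ?_
        rw [← lintegral_add_right_eq_self _ (m * v₁)]
        refine lintegral_congr fun c => ?_
        congr 1; ring
    _ = _ := by
        rw [lintegral_lintegral_swap]
        exact Measurable.aemeasurable (hh.comp (g := Function.uncurry h)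
          (f := fun p : ℝ × ℝ => (p.2 + p.1 * v₁, p.2 + p.1 * v₂)) (by fun_prop))

/-- Integration over pairs of points of the plane, through the line `u = c + m v` that joins
them and their positions `v₁`, `v₂` on it. -/
lemma lintegral_lintegral_line_coordinates {f : ℝ × ℝ → ℝ × ℝ → ENNReal}
    (hf : Measurable (Function.uncurry f)) :
    ∫⁻ z, ∫⁻ y, f z y = ∫⁻ q : ℝ × ℝ, ∫⁻ p : ℝ × ℝ, ENNReal.ofReal |p.2 - p.1| *
      f (q.1 + q.2 * p.1, p.1) (q.1 + q.2 * p.2, p.2) := by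
  have hcomp : ∀ {α : Type} [MeasurableSpace α] {a b : α → ℝ × ℝ}, Measurable a → Measurable b →
      Measurable fun x => f (a x) (b x) := fun ha hb => hf.comp (ha.prodMk hb)
  calc ∫⁻ z, ∫⁻ y, f z y
      = ∫⁻ z, ∫⁻ v₂, ∫⁻ u₂, f z (u₂, v₂) := by
        refine lintegral_congr fun z => ?_
        rw [Measure.volume_eq_prod, lintegral_prod_symm' _ (hcomp (by fun_prop) (by fun_prop))]
    _ = ∫⁻ v₁, ∫⁻ u₁, ∫⁻ v₂, ∫⁻ u₂, f (u₁, v₁) (u₂, v₂) := by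
        rw [Measure.volume_eq_prod, lintegral_prod_symm']
        refine Measurable.lintegral_prod_right' (f := fun p : (ℝ × ℝ) × ℝ =>
          ∫⁻ u₂, f p.1 (u₂, p.2)) ?_
        exact Measurable.lintegral_prod_right' (f := fun p : ((ℝ × ℝ) × ℝ) × ℝ =>
          f p.1.1 (p.2, p.1.2)) (hcomp (by fun_prop) (by fun_prop))
    _ = ∫⁻ v₁, ∫⁻ v₂, ∫⁻ u₁, ∫⁻ u₂, f (u₁, v₁) (u₂, v₂) := by
        refine lintegral_congr fun v₁ => ?_
        rw [lintegral_lintegral_swap]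
        refine Measurable.aemeasurable ?_
        exact Measurable.lintegral_prod_right' (f := fun p : (ℝ × ℝ) × ℝ =>
          f (p.1.1, v₁) (p.2, p.1.2)) (hcomp (by fun_prop) (by fun_prop))
    _ = ∫⁻ v₁, ∫⁻ v₂, ∫⁻ q : ℝ × ℝ, ENNReal.ofReal |v₂ - v₁| *
          f (q.1 + q.2 * v₁, v₁) (q.1 + q.2 * v₂, v₂) := by
        refine lintegral_congr fun v₁ => lintegral_congr_ae ?_
        filter_upwards [compl_mem_ae_iff.mpr (measure_singleton v₁)] with v₂ hv
        have hv' : v₁ ≠ v₂ := fun h => hv (by simp [h])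
        rw [lintegral_line_coordinates (hcomp (by fun_prop) (by fun_prop)) hv',
          lintegral_const_mul' _ _ ENNReal.ofReal_ne_top, Measure.volume_eq_prod,
          lintegral_prod _ (hcomp (by fun_prop) (by fun_prop)).aemeasurable]
    _ = ∫⁻ p : ℝ × ℝ, ∫⁻ q : ℝ × ℝ, ENNReal.ofReal |p.2 - p.1| *
          f (q.1 + q.2 * p.1, p.1) (q.1 + q.2 * p.2, p.2) := by
        rw [Measure.volume_eq_prod ℝ ℝ, lintegral_prod]
        refine Measurable.aemeasurable ?_
        refine Measurable.lintegral_prod_right' (f := fun x : (ℝ × ℝ) × (ℝ × ℝ) =>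
          ENNReal.ofReal |x.1.2 - x.1.1| *
          f (x.2.1 + x.2.2 * x.1.1, x.1.1) (x.2.1 + x.2.2 * x.1.2, x.1.2)) ?_
        exact Measurable.mul (by fun_prop) (hcomp (by fun_prop) (by fun_prop))
    _ = _ := by
        rw [lintegral_lintegral_swap]
        refine Measurable.aemeasurable ?_
        exact Measurable.mul (by fun_prop) (hcomp (by fun_prop) (by fun_prop))

/-! ### Strip areas and chords of the square -/

/-- The square `[-1, 1]²`. -/
def square : Set (ℝ × ℝ) := Set.Icc (-1) 1 ×ˢ Set.Icc (-1) 1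

/-- The uniform distribution on the square `[-1, 1]²`. -/
noncomputable def squareUnif : Measure (ℝ × ℝ) := cond volume square

lemma measurableSet_square : MeasurableSet square := measurableSet_Icc.prod measurableSet_Icc

lemma volume_square : volume square = 4 := by
  rw [square, Measure.volume_eq_prod, Measure.prod_prod, Real.volume_Icc,
    ← ENNReal.ofReal_mul (by norm_num)]
  norm_num

lemma squareUnif_eq : squareUnif = (4 : ENNReal)⁻¹ • volume.restrict square := by
  rw [squareUnif, ProbabilityTheory.cond, volume_square]

instance : IsProbabilityMeasure squareUnif :=
  cond_isProbabilityMeasure_of_finite (by rw [volume_square]; norm_num)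
    (by rw [volume_square]; norm_num)

lemma squareUnif_apply {s : Set (ℝ × ℝ)} (hs : MeasurableSet s) :
    squareUnif s = 4⁻¹ * volume (s ∩ square) := by
  rw [squareUnif_eq, Measure.smul_apply, Measure.restrict_apply hs, smul_eq_mul]

lemma lintegral_squareUnif (f : ℝ × ℝ → ENNReal) :
    ∫⁻ z, f z ∂squareUnif = 4⁻¹ * ∫⁻ z, square.indicator 1 z * f z := by
  rw [squareUnif_eq, lintegral_smul_measure, smul_eq_mul,
    ← lintegral_indicator measurableSet_square]
  congr 2
  ext z
  by_cases hz : z ∈ square <;> simp [hz]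

/-- The part of the square that lies in the strip `|u - m v| ≤ |c|`, as a fraction. -/
noncomputable def stripArea (c m : ℝ) : ENNReal := squareUnif {w | |w.1 - m * w.2| ≤ |c|}

/-- The ordinates of the points of the line `u = c + m v` in the square. -/
def chord (c m : ℝ) : Set ℝ := {v | v ∈ Set.Icc (-1) 1 ∧ c + m * v ∈ Set.Icc (-1) 1}

/-- The integral of the distance of two points of a set of reals. -/
noncomputable def distIntegral (s : Set ℝ) : ENNReal :=
  ∫⁻ v₁ in s, ∫⁻ v₂ in s, ENNReal.ofReal |v₂ - v₁|

lemma measurableSet_chord (c m : ℝ) : MeasurableSet (chord c m) :=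
  measurableSet_Icc.inter (measurableSet_Icc.preimage (by fun_prop))

lemma openStrip_line {c m v₁ v₂ : ℝ} (h : v₁ ≠ v₂) :
    openStrip (c + m * v₁, v₁) (c + m * v₂, v₂) = {w | |w.1 - m * w.2| < |c|} := by
  have hd : 0 < |v₂ - v₁| := abs_pos.mpr (sub_ne_zero.mpr h.symm)
  ext w
  simp only [openStrip, Set.mem_ofPred_eq, cross, Prod.fst_sub, Prod.snd_sub]
  rw [show w.1 * (v₂ - v₁) - w.2 * (c + m * v₂ - (c + m * v₁)) =
    (w.1 - m * w.2) * (v₂ - v₁) by ring,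
    show (c + m * v₁) * v₂ - v₁ * (c + m * v₂) = c * (v₂ - v₁) by ring, abs_mul, abs_mul,
    mul_lt_mul_iff_left₀ hd]

lemma closedStrip_line {c m v₁ v₂ : ℝ} (h : v₁ ≠ v₂) :
    closedStrip (c + m * v₁, v₁) (c + m * v₂, v₂) = {w | |w.1 - m * w.2| ≤ |c|} := by
  have hd : 0 < |v₂ - v₁| := abs_pos.mpr (sub_ne_zero.mpr h.symm)
  ext w
  simp only [closedStrip, Set.mem_ofPred_eq, cross, Prod.fst_sub, Prod.snd_sub]
  rw [show w.1 * (v₂ - v₁) - w.2 * (c + m * v₂ - (c + m * v₁)) =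
    (w.1 - m * w.2) * (v₂ - v₁) by ring,
    show (c + m * v₁) * v₂ - v₁ * (c + m * v₂) = c * (v₂ - v₁) by ring, abs_mul, abs_mul,
    mul_le_mul_iff_left₀ hd]

lemma volume_line_eq_zero (m a : ℝ) : volume {w : ℝ × ℝ | w.1 - m * w.2 = a} = 0 := by
  have hm : MeasurableSet {w : ℝ × ℝ | w.1 - m * w.2 = a} :=
    measurableSet_eq_fun (by fun_prop) (by fun_prop)
  rw [Measure.volume_eq_prod, Measure.prod_apply_symm hm]
  refine (lintegral_congr fun y => ?_).trans lintegral_zero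
  have : (fun x : ℝ => (x, y)) ⁻¹' {w : ℝ × ℝ | w.1 - m * w.2 = a} = {a + m * y} := by
    ext x; simp only [Set.mem_preimage, Set.mem_ofPred_eq, Set.mem_singleton_iff]
    exact sub_eq_iff_eq_add
  rw [this, Real.volume_singleton]

/-- The strips differ only by boundary lines, which are null. This makes the upper and lower bounds
for the probability coincide. -/
lemma squareUnif_strip_lt (c m : ℝ) : squareUnif {w | |w.1 - m * w.2| < |c|} = stripArea c m := by
  have hac : squareUnif ≪ volume := cond_absolutelyContinuous
  refine le_antisymm (measure_mono fun w hw => ?_) ?_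
  · simp only [Set.mem_ofPred_eq] at *; exact hw.le
  · have hsub : {w : ℝ × ℝ | |w.1 - m * w.2| ≤ |c|} ⊆ {w | |w.1 - m * w.2| < |c|} ∪
        ({w | w.1 - m * w.2 = |c|} ∪ {w | w.1 - m * w.2 = -|c|}) := by
      intro w hw
      simp only [Set.mem_ofPred_eq, Set.mem_union] at *
      rcases hw.lt_or_eq with h | h
      · exact Or.inl h
      · exact Or.inr (eq_or_eq_neg_of_abs_eq h)
    refine (measure_mono hsub).trans ((measure_union_le _ _).trans ?_)
    rw [measure_union_null (hac (volume_line_eq_zero m _)) (hac (volume_line_eq_zero m _)),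
      add_zero]

lemma distIntegral_eq_indicator {s : Set ℝ} (hs : MeasurableSet s) :
    distIntegral s = ∫⁻ p : ℝ × ℝ, ENNReal.ofReal |p.2 - p.1| *
      (s.indicator 1 p.1 * s.indicator 1 p.2) := by
  have h1 : Measurable (s.indicator (1 : ℝ → ENNReal)) := measurable_one.indicator hs
  rw [distIntegral, Measure.volume_eq_prod, lintegral_prod _ (by fun_prop),
    ← lintegral_indicator hs]
  refine lintegral_congr fun v => ?_
  by_cases hv : v ∈ s
  · rw [Set.indicator_of_mem hv, ← lintegral_indicator hs]
    refine lintegral_congr fun w => ?_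
    by_cases hw : w ∈ s <;> simp [hv, hw]
  · simp [hv]

/-- The integral of powers of strip areas in line coordinates. -/
lemma lintegral_strip_pow {S : ℝ × ℝ → ℝ × ℝ → Set (ℝ × ℝ)} (n : ℕ)
    (hS : MeasurableSet {p : ((ℝ × ℝ) × (ℝ × ℝ)) × (ℝ × ℝ) | p.2 ∈ S p.1.1 p.1.2})
    (hline : ∀ c m v₁ v₂ : ℝ, v₁ ≠ v₂ →
      squareUnif (S (c + m * v₁, v₁) (c + m * v₂, v₂)) = stripArea c m) :
    ∫⁻ z, ∫⁻ y, squareUnif (S z y) ^ n ∂squareUnif ∂squareUnif =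
      4⁻¹ * (4⁻¹ * ∫⁻ q : ℝ × ℝ, stripArea q.1 q.2 ^ n * distIntegral (chord q.1 q.2)) := by
  have hg : Measurable fun p : (ℝ × ℝ) × (ℝ × ℝ) => squareUnif (S p.1 p.2) :=
    measurable_measure_prodMk_left hS
  have hi : Measurable (square.indicator (1 : ℝ × ℝ → ENNReal)) :=
    measurable_one.indicator measurableSet_square
  calc ∫⁻ z, ∫⁻ y, squareUnif (S z y) ^ n ∂squareUnif ∂squareUnif
      = 4⁻¹ * (4⁻¹ * ∫⁻ z, ∫⁻ y, square.indicator 1 z * (square.indicator 1 y *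
          squareUnif (S z y) ^ n)) := by
        rw [lintegral_squareUnif]
        simp_rw [lintegral_squareUnif]
        congr 1
        rw [← lintegral_const_mul' _ _ (by simp)]
        refine lintegral_congr fun z => ?_
        rw [mul_left_comm, ← lintegral_const_mul' (square.indicator 1 z)]
        by_cases hz : z ∈ square <;> simp [hz]
    _ = _ := by
        congr 2
        rw [lintegral_lintegral_line_coordinates (f := fun z y => square.indicator 1 z *
          (square.indicator 1 y * squareUnif (S z y) ^ n))]
        · refine lintegral_congr fun q => ?_
          rw [distIntegral_eq_indicator (measurableSet_chord _ _), ← lintegral_const_mul']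
          · refine lintegral_congr fun p => ?_
            have hind : ∀ v, square.indicator (1 : ℝ × ℝ → ENNReal) (q.1 + q.2 * v, v) =
                (chord q.1 q.2).indicator 1 v := by
              intro v
              simp only [Set.indicator_apply, square, chord, Set.mem_prod, Set.mem_ofPred_eq,
                and_comm, Pi.one_apply]
            rw [hind, hind]
            by_cases hp : p.1 = p.2
            · simp [hp]
            · rw [hline _ _ _ _ hp]; ring
          · exact ENNReal.pow_ne_top (measure_ne_top _ _)
        · exact (hi.comp measurable_fst).mul ((hi.comp measurable_snd).mul (hg.pow_const n))

lemma distIntegral_neg {s : Set ℝ} (hs : MeasurableSet s) :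
    distIntegral (-s) = distIntegral s := by
  have hneg : ∀ v : ℝ, (-s).indicator (1 : ℝ → ENNReal) v = s.indicator 1 (-v) := by
    intro v
    by_cases h : -v ∈ s
    · rw [Set.indicator_of_mem (Set.mem_neg.mpr h), Set.indicator_of_mem h, Pi.one_apply,
        Pi.one_apply]
    · rw [Set.indicator_of_notMem (fun h' => h (Set.mem_neg.mp h')), Set.indicator_of_notMem h]
  rw [distIntegral_eq_indicator hs, distIntegral_eq_indicator hs.neg,
    ← lintegral_neg_eq_self]
  refine lintegral_congr fun p => ?_
  rw [hneg, hneg, Prod.fst_neg, Prod.snd_neg, neg_neg, neg_neg, ← abs_neg]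
  congr 3; ring

lemma chord_neg_left (c m : ℝ) : chord (-c) m = -chord c m := by
  ext v
  simp only [chord, Set.mem_neg, Set.mem_ofPred_eq, Set.mem_Icc]
  constructor <;> rintro ⟨⟨h1, h2⟩, h3, h4⟩ <;> refine ⟨⟨?_, ?_⟩, ?_, ?_⟩ <;> linarith

lemma chord_neg_right (c m : ℝ) : chord c (-m) = -chord c m := by
  ext v
  simp only [chord, Set.mem_neg, Set.mem_ofPred_eq, Set.mem_Icc]
  constructor <;> rintro ⟨⟨h1, h2⟩, h3, h4⟩ <;> refine ⟨⟨?_, ?_⟩, ?_, ?_⟩ <;> linarith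

lemma measurableSet_strip (c m : ℝ) : MeasurableSet {w : ℝ × ℝ | |w.1 - m * w.2| ≤ c} :=
  measurableSet_le (by fun_prop) (by fun_prop)

lemma stripArea_neg_left (c m : ℝ) : stripArea (-c) m = stripArea c m := by
  simp only [stripArea, abs_neg]

lemma stripArea_neg_right (c m : ℝ) : stripArea c (-m) = stripArea c m := by
  have hmp : MeasurePreserving (Prod.map id Neg.neg) (volume : Measure (ℝ × ℝ)) volume :=
    (MeasurePreserving.id volume).prod (Measure.measurePreserving_neg volume)
  rw [stripArea, stripArea, squareUnif_apply (measurableSet_strip _ _),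
    squareUnif_apply (measurableSet_strip _ _), ← hmp.measure_preimage
      ((measurableSet_strip _ _).inter measurableSet_square).nullMeasurableSet]
  congr 2
  ext w
  simp only [square, Set.mem_inter_iff, Set.mem_ofPred_eq, Set.mem_prod, Set.mem_Icc,
    Set.mem_preimage, Prod.map_fst, Prod.map_snd, id]
  rw [show w.1 - -m * -w.2 = w.1 - m * w.2 by ring]
  refine and_congr_right fun _ => and_congr_right fun _ => ?_
  constructor <;> rintro ⟨h1, h2⟩ <;> constructor <;> linarith

lemma distIntegral_Icc {a b : ℝ} (hab : a ≤ b) :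
    distIntegral (Set.Icc a b) = ENNReal.ofReal ((b - a) ^ 3 / 3) := by
  have hin : ∀ v ∈ Set.Icc a b, ∫⁻ w in Set.Icc a b, ENNReal.ofReal |w - v| =
      ENNReal.ofReal (((v - a) ^ 2 + (b - v) ^ 2) / 2) := by
    intro v hv
    rw [setLIntegral_congr Ioc_ae_eq_Icc.symm, ← Set.Ioc_union_Ioc_eq_Ioc hv.1 hv.2,
      lintegral_union measurableSet_Ioc (Set.Ioc_disjoint_Ioc_of_le le_rfl),
      add_div, ENNReal.ofReal_add (by positivity) (by positivity)]
    congr 1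
    · rw [setLIntegral_congr_fun measurableSet_Ioc (g := fun w => ENNReal.ofReal (v - w))
        (fun w hw => by simp only [abs_of_nonpos (sub_nonpos.mpr hw.2), neg_sub]),
        lintegral_Ioc_ofReal_eq_sub (G := fun w => -((v - w) ^ 2 / 2)) hv.1]
      · congr 1; ring
      · intro x _
        exact ((((hasDerivAt_id' x).const_sub v).pow 2).div_const 2).neg.congr_deriv
          (by norm_num; ring)
      · fun_prop
      · intro x hx; linarith [hx.2]
    · rw [setLIntegral_congr_fun measurableSet_Ioc (g := fun w => ENNReal.ofReal (w - v))
        (fun w hw => by simp only [abs_of_nonneg (sub_nonneg.mpr hw.1.le)]),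
        lintegral_Ioc_ofReal_eq_sub (G := fun w => (w - v) ^ 2 / 2) hv.2]
      · congr 1; ring
      · intro x _
        exact ((((hasDerivAt_id' x).sub_const v).pow 2).div_const 2).congr_deriv
          (by norm_num)
      · fun_prop
      · intro x hx; linarith [hx.1]
  rw [distIntegral, setLIntegral_congr_fun measurableSet_Icc hin,
    setLIntegral_congr Ioc_ae_eq_Icc.symm,
    lintegral_Ioc_ofReal_eq_sub (G := fun v => ((v - a) ^ 3 - (b - v) ^ 3) / 6) hab]
  · congr 1; ring
  · intro x _
    exact (((((hasDerivAt_id' x).sub_const a).pow 3).sub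
      (((hasDerivAt_id' x).const_sub b).pow 3)).div_const 6).congr_deriv (by norm_num; ring)
  · fun_prop
  · intro x _; positivity

lemma chord_eq_of_add_le {c m : ℝ} (hc : 0 < c) (hm : 0 < m) (h : c + m ≤ 1) :
    chord c m = Set.Icc (-1) 1 := by
  ext v
  simp only [chord, Set.mem_ofPred_eq, Set.mem_Icc, and_iff_left_iff_imp]
  rintro ⟨h1, h2⟩
  constructor <;> nlinarith

lemma chord_eq_of_add_one_le {c m : ℝ} (hc : 0 < c) (h : c + 1 ≤ m) :
    chord c m = Set.Icc ((-1 - c) / m) ((1 - c) / m) := by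
  have hm : 0 < m := by linarith
  ext v
  simp only [chord, Set.mem_ofPred_eq, Set.mem_Icc, div_le_iff₀ hm, le_div_iff₀ hm]
  constructor
  · rintro ⟨_, h1, h2⟩; constructor <;> linarith
  · rintro ⟨h1, h2⟩
    refine ⟨⟨?_, ?_⟩, ?_, ?_⟩ <;> nlinarith

/-- The line enters at `v = -1` and leaves through the side `u = 1`, cutting off the corner `(1,
-1)`. -/
lemma chord_eq_of_corner {c m : ℝ} (hm : 0 < m) (h1 : 1 ≤ c + m) (h2 : m ≤ c + 1) :
    chord c m = Set.Icc (-1) ((1 - c) / m) := by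
  ext v
  simp only [chord, Set.mem_ofPred_eq, Set.mem_Icc, le_div_iff₀ hm]
  constructor
  · rintro ⟨⟨h1, _⟩, _, h2⟩; constructor <;> linarith
  · rintro ⟨h1, h2⟩
    refine ⟨⟨?_, ?_⟩, ?_, ?_⟩ <;> nlinarith

lemma chord_eq_empty {c m : ℝ} (hm : 0 < m) (h : m + 1 < c) : chord c m = ∅ := by
  ext v
  simp only [chord, Set.mem_ofPred_eq, Set.mem_Icc, Set.mem_empty_iff_false, iff_false]
  rintro ⟨⟨h1, _⟩, _, h2⟩
  nlinarith

lemma stripArea_eq_lintegral_fst {c : ℝ} (hc : 0 < c) (m : ℝ) :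
    stripArea c m = 4⁻¹ * ∫⁻ v in Set.Ioc (-1) 1,
      ENNReal.ofReal (min 1 (m * v + c) - max (-1) (m * v - c)) := by
  rw [stripArea, squareUnif_apply (measurableSet_strip _ _), Measure.volume_eq_prod,
    Measure.prod_apply_symm ((measurableSet_strip _ _).inter measurableSet_square),
    setLIntegral_congr Ioc_ae_eq_Icc, ← lintegral_indicator measurableSet_Icc]
  congr 1
  refine lintegral_congr fun v => ?_
  by_cases hv : v ∈ Set.Icc (-1 : ℝ) 1
  · rw [Set.indicator_of_mem hv, ← Real.volume_Icc, ← Set.Icc_inter_Icc]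
    congr 1
    ext u
    simp only [Set.mem_preimage, Set.mem_inter_iff, Set.mem_ofPred_eq, square, Set.mem_prod, hv,
      and_true, abs_of_pos hc, abs_le, Set.mem_Icc]
    constructor
    · rintro ⟨⟨h1, h2⟩, h3, h4⟩; refine ⟨⟨?_, ?_⟩, ?_, ?_⟩ <;> linarith
    · rintro ⟨⟨h1, h2⟩, h3, h4⟩; refine ⟨⟨?_, ?_⟩, ?_, ?_⟩ <;> linarith
  · rw [Set.indicator_of_notMem hv]
    convert measure_empty (μ := (volume : Measure ℝ))
    ext u
    simp only [Set.mem_preimage, Set.mem_inter_iff, square, Set.mem_prod, hv, and_false,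
      Set.mem_empty_iff_false]

/-- Every slice at fixed `v` has the full width `2c`, as the strip does not reach the sides `u = ±
1`. -/
lemma stripArea_eq_of_add_le {c m : ℝ} (hc : 0 < c) (hm : 0 < m) (h : c + m ≤ 1) :
    stripArea c m = ENNReal.ofReal c := by
  rw [stripArea_eq_lintegral_fst hc, setLIntegral_congr_fun measurableSet_Ioc
    (g := fun _ => ENNReal.ofReal (2 * c)), setLIntegral_const, Real.volume_Ioc,
    ← ENNReal.ofReal_mul (by linarith), show (4 : ENNReal)⁻¹ = ENNReal.ofReal 4⁻¹ by
      rw [ENNReal.ofReal_inv_of_pos (by norm_num)]; norm_num,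
    ← ENNReal.ofReal_mul (by norm_num)]
  · congr 1; ring
  · intro v hv
    obtain ⟨h1, h2⟩ := hv
    beta_reduce
    rw [min_eq_right (by nlinarith), max_eq_right (by nlinarith)]
    congr 1; ring

/-- Here the strip avoids the sides `v = ± 1`, so slices at fixed `u` are used; each has length `2c
/ m`. -/
lemma stripArea_eq_of_add_one_le {c m : ℝ} (hc : 0 < c) (h : c + 1 ≤ m) :
    stripArea c m = ENNReal.ofReal (c / m) := by
  have hm : 0 < m := by linarith
  rw [stripArea, squareUnif_apply (measurableSet_strip _ _), Measure.volume_eq_prod,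
    Measure.prod_apply ((measurableSet_strip _ _).inter measurableSet_square)]
  have : ∀ u : ℝ, volume (Prod.mk u ⁻¹' ({w | |w.1 - m * w.2| ≤ |c|} ∩ square)) =
      (Set.Icc (-1 : ℝ) 1).indicator (fun _ => ENNReal.ofReal (2 * (c / m))) u := by
    intro u
    by_cases hu : u ∈ Set.Icc (-1 : ℝ) 1
    · rw [Set.indicator_of_mem hu, show 2 * (c / m) = (u + c) / m - (u - c) / m by ring,
        ← Real.volume_Icc]
      congr 1
      ext v
      simp only [Set.mem_preimage, Set.mem_inter_iff, Set.mem_ofPred_eq, square, Set.mem_prod, hu,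
        true_and, abs_of_pos hc, abs_le, Set.mem_Icc, div_le_iff₀ hm, le_div_iff₀ hm]
      obtain ⟨hu1, hu2⟩ := hu
      constructor
      · rintro ⟨⟨h1, h2⟩, h3, h4⟩; constructor <;> linarith
      · rintro ⟨h1, h2⟩; refine ⟨⟨?_, ?_⟩, ?_, ?_⟩ <;> nlinarith
    · rw [Set.indicator_of_notMem hu]
      convert measure_empty (μ := (volume : Measure ℝ))
      ext v
      simp only [Set.mem_preimage, Set.mem_inter_iff, square, Set.mem_prod, hu, false_and,
        and_false, Set.mem_empty_iff_false]
  simp_rw [this]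
  rw [lintegral_indicator measurableSet_Icc, setLIntegral_const, Real.volume_Icc,
    ← ENNReal.ofReal_mul (by positivity), show (4 : ENNReal)⁻¹ = ENNReal.ofReal 4⁻¹ by
      rw [ENNReal.ofReal_inv_of_pos (by norm_num)]; norm_num,
    ← ENNReal.ofReal_mul (by norm_num)]
  congr 1; ring

/-- This is the area of the corner triangle beyond the strip, with legs `1 + m - c` and `(1 + m - c)
/ m`. -/
lemma integral_max_zero_sub_mul {c m : ℝ} (hm : 0 < m) (h1 : 1 ≤ c + m) (h3 : c ≤ m + 1) :
    ∫ v in (-1 : ℝ)..1, max 0 (1 - c - m * v) = (1 + m - c) ^ 2 / (2 * m) := by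
  have hb1 : -1 ≤ (1 - c) / m := by rw [le_div_iff₀ hm]; linarith
  have hb2 : (1 - c) / m ≤ 1 := by rw [div_le_iff₀ hm]; linarith
  have hcont : Continuous fun v : ℝ => max 0 (1 - c - m * v) := by fun_prop
  rw [← intervalIntegral.integral_add_adjacent_intervals (b := (1 - c) / m)
    (hcont.intervalIntegrable _ _) (hcont.intervalIntegrable _ _)]
  have e1 : ∫ v in (-1 : ℝ)..((1 - c) / m), max 0 (1 - c - m * v) =
      ∫ v in (-1 : ℝ)..((1 - c) / m), (1 - c - m * v) := by
    refine intervalIntegral.integral_congr fun v hv => ?_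
    rw [Set.uIcc_of_le hb1] at hv
    have := (le_div_iff₀ hm).mp hv.2
    exact max_eq_right (by linarith)
  have e2 : ∫ v in ((1 - c) / m)..1, max 0 (1 - c - m * v) = ∫ v in ((1 - c) / m)..1, (0 : ℝ) := by
    refine intervalIntegral.integral_congr fun v hv => ?_
    rw [Set.uIcc_of_le hb2] at hv
    have := (div_le_iff₀ hm).mp hv.1
    exact max_eq_left (by linarith)
  rw [e1, e2, intervalIntegral.integral_zero, add_zero,
    intervalIntegral.integral_eq_sub_of_hasDerivAt (f := fun v => (1 - c) * v - m * (v ^ 2 / 2))]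
  · field_simp; ring
  · intro x _
    exact (((hasDerivAt_id' x).const_mul (1 - c)).sub
      ((((hasDerivAt_id' x).pow 2).div_const 2).const_mul m)).congr_deriv (by norm_num)
  · exact Continuous.intervalIntegrable (by fun_prop) _ _

/-- The strip misses two opposite corner triangles of equal area; the slice length is 2 minus the
two triangle slices. -/
lemma stripArea_eq_of_corner {c m : ℝ} (hc : 0 < c) (hm : 0 < m) (h1 : 1 ≤ c + m)
    (h2 : m ≤ c + 1) (h3 : c ≤ m + 1) :
    stripArea c m = ENNReal.ofReal (1 - m * ((1 + m - c) / m) ^ 2 / 4) := by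
  have hfun : ∀ v ∈ Set.Icc (-1 : ℝ) 1, min 1 (m * v + c) - max (-1) (m * v - c) =
      2 - max 0 (1 - c - m * v) - max 0 (1 - c - m * (-v)) := by
    rintro v ⟨hv1, hv2⟩
    have e1 : min 1 (m * v + c) = 1 - max 0 (1 - c - m * v) := by
      rcases le_total 1 (m * v + c) with h | h
      · rw [min_eq_left h, max_eq_left (by linarith)]; ring
      · rw [min_eq_right h, max_eq_right (by linarith)]; ring
    have e2 : max (-1) (m * v - c) = -1 + max 0 (1 - c - m * (-v)) := by
      rcases le_total (-1) (m * v - c) with h | h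
      · rw [max_eq_right h, max_eq_right (by linarith)]; ring
      · rw [max_eq_left h, max_eq_left (by linarith)]; ring
    rw [e1, e2]; ring
  have hcont : Continuous fun v : ℝ => min 1 (m * v + c) - max (-1) (m * v - c) := by fun_prop
  have hint : ∫ v in (-1 : ℝ)..1, (min 1 (m * v + c) - max (-1) (m * v - c)) =
      4 - (1 + m - c) ^ 2 / m := by
    rw [intervalIntegral.integral_congr (g := fun v =>
      2 - max 0 (1 - c - m * v) - max 0 (1 - c - m * (-v)))
      (fun v hv => hfun v (by rwa [Set.uIcc_of_le (by norm_num)] at hv)),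
      intervalIntegral.integral_sub (Continuous.intervalIntegrable (by fun_prop) _ _)
        (Continuous.intervalIntegrable (by fun_prop) _ _),
      intervalIntegral.integral_sub (Continuous.intervalIntegrable (by fun_prop) _ _)
        (Continuous.intervalIntegrable (by fun_prop) _ _),
      intervalIntegral.integral_comp_neg (fun v => max 0 (1 - c - m * v)), neg_neg,
      integral_max_zero_sub_mul hm h1 h3, intervalIntegral.integral_const, smul_eq_mul]
    field_simp; ring
  rw [stripArea_eq_lintegral_fst hc, ← ofReal_integral_eq_lintegral_ofReal
    (hcont.intervalIntegrable (-1) 1).1, ← intervalIntegral.integral_of_le (by norm_num), hint,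
    show (4 : ENNReal)⁻¹ = ENNReal.ofReal 4⁻¹ by
      rw [ENNReal.ofReal_inv_of_pos (by norm_num)]; norm_num,
    ← ENNReal.ofReal_mul (by norm_num)]
  · congr 1; field_simp
  · filter_upwards [ae_restrict_mem measurableSet_Ioc] with v hv
    obtain ⟨hv1, hv2⟩ := hv
    refine sub_nonneg.mpr (max_le (le_min (by norm_num) ?_) (le_min ?_ ?_)) <;> nlinarith

lemma measurable_stripArea : Measurable fun q : ℝ × ℝ => stripArea q.1 q.2 :=
  measurable_measure_prodMk_left (ν := squareUnif)
    (s := {p : (ℝ × ℝ) × (ℝ × ℝ) | |p.2.1 - p.1.2 * p.2.2| ≤ |p.1.1|})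
    (measurableSet_le (by fun_prop) (by fun_prop))

lemma measurable_distIntegral_chord :
    Measurable fun q : ℝ × ℝ => distIntegral (chord q.1 q.2) := by
  have hT : MeasurableSet {x : (ℝ × ℝ) × ℝ | x.2 ∈ chord x.1.1 x.1.2} :=
    (measurableSet_Icc.preimage measurable_snd).inter
      (measurableSet_Icc.preimage (f := fun x : (ℝ × ℝ) × ℝ => x.1.1 + x.1.2 * x.2) (by fun_prop))
  have hi := (measurable_one (α := ENNReal)).indicator hT
  have h : ∀ q : ℝ × ℝ, distIntegral (chord q.1 q.2) = ∫⁻ p : ℝ × ℝ,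
      ENNReal.ofReal |p.2 - p.1| *
      ({x : (ℝ × ℝ) × ℝ | x.2 ∈ chord x.1.1 x.1.2}.indicator 1 (q, p.1) *
        {x : (ℝ × ℝ) × ℝ | x.2 ∈ chord x.1.1 x.1.2}.indicator 1 (q, p.2)) :=
    fun q => distIntegral_eq_indicator (measurableSet_chord _ _)
  simp_rw [h]
  refine Measurable.lintegral_prod_right' (f := fun y : (ℝ × ℝ) × (ℝ × ℝ) =>
    ENNReal.ofReal |y.2.2 - y.2.1| *
      ({x : (ℝ × ℝ) × ℝ | x.2 ∈ chord x.1.1 x.1.2}.indicator 1 (y.1, y.2.1) *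
        {x : (ℝ × ℝ) × ℝ | x.2 ∈ chord x.1.1 x.1.2}.indicator 1 (y.1, y.2.2))) ?_
  refine Measurable.mul (by fun_prop) (Measurable.mul ?_ ?_)
  · exact hi.comp (g := _) (f := fun y : (ℝ × ℝ) × (ℝ × ℝ) => (y.1, y.2.1)) (by fun_prop)
  · exact hi.comp (g := _) (f := fun y : (ℝ × ℝ) × (ℝ × ℝ) => (y.1, y.2.2)) (by fun_prop)

/-! ### The integral over lines, by the sides of the square that they meet -/

lemma hasDerivAt_one_sub_pow_div (k : ℕ) (t : ℝ) :
    HasDerivAt (fun t : ℝ => (1 - t) ^ (k + 1) / (k + 1)) (-(1 - t) ^ k) t := by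
  have hk : (k : ℝ) + 1 ≠ 0 := by positivity
  refine ((((hasDerivAt_id' t).const_sub 1).pow (k + 1)).div_const ((k : ℝ) + 1)).congr_deriv ?_
  simp only [Nat.add_sub_cancel]
  push_cast
  field_simp

lemma lintegral_pow_Ioc (n : ℕ) {b K : ℝ} (hb : 0 ≤ b) (hK : 0 ≤ K) :
    ∫⁻ c in Set.Ioc 0 b, ENNReal.ofReal (K * c ^ n) =
      ENNReal.ofReal (K * (b ^ (n + 1) / (n + 1))) := by
  have hn : (n : ℝ) + 1 ≠ 0 := by positivity
  rw [lintegral_Ioc_ofReal_eq_sub (G := fun c => K * (c ^ (n + 1) / (n + 1))) hb]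
  · congr 1; simp
  · intro x _
    refine ((((hasDerivAt_id' x).pow (n + 1)).div_const ((n : ℝ) + 1)).const_mul K).congr_deriv ?_
    simp only [Nat.add_sub_cancel]
    push_cast
    field_simp
  · fun_prop
  · intro x hx
    have := hx.1
    positivity

/-- Lines that meet the two sides `v = ± 1`. -/
lemma lintegral_vertical_chords (n : ℕ) :
    ∫⁻ m in Set.Ioc (0 : ℝ) 1, ∫⁻ c in Set.Ioc 0 |m - 1|,
      stripArea c m ^ n * distIntegral (chord c m) =
      ENNReal.ofReal (8 / 3 / ((n + 1) * (n + 2))) := by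
  have hin : ∀ m ∈ Set.Ioc (0 : ℝ) 1, ∫⁻ c in Set.Ioc 0 |m - 1|,
      stripArea c m ^ n * distIntegral (chord c m) =
      ENNReal.ofReal (8 / 3 * ((1 - m) ^ (n + 1) / (n + 1))) := by
    rintro m ⟨hm0, hm1⟩
    rw [show |m - 1| = 1 - m by rw [abs_of_nonpos (by linarith)]; ring,
      ← lintegral_pow_Ioc n (by linarith) (by norm_num)]
    refine setLIntegral_congr_fun measurableSet_Ioc fun c hc => ?_
    obtain ⟨h1, h2⟩ := hc
    rw [stripArea_eq_of_add_le h1 hm0 (by linarith), chord_eq_of_add_le h1 hm0 (by linarith),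
      distIntegral_Icc (by norm_num), ← ENNReal.ofReal_pow h1.le,
      ← ENNReal.ofReal_mul (by positivity)]
    congr 1; ring
  rw [setLIntegral_congr_fun measurableSet_Ioc hin, lintegral_Ioc_ofReal_eq_sub
    (G := fun m => -(8 / 3 / (n + 1) * ((1 - m) ^ ((n + 1) + 1) / (((n + 1 : ℕ) : ℝ) + 1))))
    zero_le_one]
  · congr 1
    have : (n : ℝ) + 1 ≠ 0 := by positivity
    have : (n : ℝ) + 2 ≠ 0 := by positivity
    have : (n : ℝ) + 1 + 1 ≠ 0 := by positivity
    push_cast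
    simp only [sub_self, sub_zero, one_pow]
    rw [zero_pow (by omega)]
    field_simp
    ring
  · intro x _
    refine ((hasDerivAt_one_sub_pow_div (n + 1) x).const_mul (8 / 3 / ((n : ℝ) + 1))).neg.congr_deriv
      ?_
    ring
  · fun_prop
  · intro x hx
    have : 0 ≤ 1 - x := by linarith [hx.2]
    positivity

/-- Lines that meet the two sides `u = ± 1`. -/
lemma lintegral_horizontal_chords (n : ℕ) :
    ∫⁻ m in Set.Ioi (1 : ℝ), ∫⁻ c in Set.Ioc 0 |m - 1|,
      stripArea c m ^ n * distIntegral (chord c m) =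
      ENNReal.ofReal (8 / 3 / ((n + 1) * (n + 2))) := by
  have hin : ∀ m ∈ Set.Ioi (1 : ℝ), ∫⁻ c in Set.Ioc 0 |m - 1|,
      stripArea c m ^ n * distIntegral (chord c m) =
      ENNReal.ofReal (8 / 3 / (n + 1) * ((1 - m⁻¹) ^ (n + 1) * (m ^ 2)⁻¹)) := by
    intro m hm
    have hm : 1 < m := hm
    have hm0 : 0 < m := by linarith
    have e : 8 / 3 / ((n : ℝ) + 1) * ((1 - m⁻¹) ^ (n + 1) * (m ^ 2)⁻¹) =
        8 / 3 / m ^ (n + 3) * ((m - 1) ^ (n + 1) / (n + 1)) := by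
      rw [show 1 - m⁻¹ = (m - 1) / m by field_simp, div_pow]
      have : (n : ℝ) + 1 ≠ 0 := by positivity
      field_simp
      ring
    rw [show |m - 1| = m - 1 by rw [abs_of_nonneg (by linarith)], e,
      ← lintegral_pow_Ioc n (by linarith) (by positivity)]
    refine setLIntegral_congr_fun measurableSet_Ioc fun c hc => ?_
    obtain ⟨h1, h2⟩ := hc
    rw [stripArea_eq_of_add_one_le h1 (by linarith), chord_eq_of_add_one_le h1 (by linarith),
      distIntegral_Icc (by gcongr; linarith), ← ENNReal.ofReal_pow (by positivity),
      ← ENNReal.ofReal_mul (by positivity)]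
    congr 1
    rw [div_pow c m n]
    field_simp
    ring
  -- The antiderivative comes from the substitution `1 - m⁻¹`, whose derivative is `(m ^ 2)⁻¹`.
  have hder : ∀ x ∈ Set.Ici (1 : ℝ), HasDerivAt (fun m : ℝ => 8 / 3 / ((n : ℝ) + 1) *
      ((1 - m⁻¹) ^ ((n + 1) + 1) / (((n + 1 : ℕ) : ℝ) + 1)))
      (8 / 3 / (n + 1) * ((1 - x⁻¹) ^ (n + 1) * (x ^ 2)⁻¹)) x := by
    intro x hx
    have hx0 : x ≠ 0 := by have : 1 ≤ x := hx; linarith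
    refine (((hasDerivAt_one_sub_pow_div (n + 1) x⁻¹).comp x (hasDerivAt_inv hx0)).const_mul
      (8 / 3 / ((n : ℝ) + 1))).congr_deriv ?_
    ring
  have hpos : ∀ x ∈ Set.Ioi (1 : ℝ),
      0 ≤ 8 / 3 / ((n : ℝ) + 1) * ((1 - x⁻¹) ^ (n + 1) * (x ^ 2)⁻¹) := by
    intro x hx
    have hx : 1 < x := hx
    have : 0 ≤ 1 - x⁻¹ := sub_nonneg.mpr (inv_le_one_of_one_le₀ hx.le)
    positivity
  have hlim : Filter.Tendsto (fun m : ℝ => 8 / 3 / ((n : ℝ) + 1) *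
      ((1 - m⁻¹) ^ ((n + 1) + 1) / (((n + 1 : ℕ) : ℝ) + 1))) Filter.atTop
      (nhds (8 / 3 / ((n : ℝ) + 1) * ((1 - 0) ^ ((n + 1) + 1) / (((n + 1 : ℕ) : ℝ) + 1)))) :=
    (((tendsto_inv_atTop_zero.const_sub 1).pow _).div_const _).const_mul _
  rw [setLIntegral_congr_fun measurableSet_Ioi hin, ← ofReal_integral_eq_lintegral_ofReal
    (integrableOn_Ioi_deriv_of_nonneg' hder hpos hlim),
    integral_Ioi_of_hasDerivAt_of_nonneg' hder hpos hlim]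
  · congr 1
    have : (n : ℝ) + 1 ≠ 0 := by positivity
    have : (n : ℝ) + 2 ≠ 0 := by positivity
    have : (n : ℝ) + 1 + 1 ≠ 0 := by positivity
    push_cast
    simp only [sub_self, sub_zero, one_pow, inv_one]
    rw [zero_pow (by omega)]
    field_simp
    ring
  · filter_upwards [ae_restrict_mem measurableSet_Ioi] with x hx using hpos x hx

/-- Integration by parts in `m` gives an antiderivative. The quotient `(1 - (1 - t) ^ (n + 2)) / t`
at the endpoints is then unfolded into a geometric sum, so that no `1 / t` remains for the
integration in `t`. -/
lemma lintegral_corner_slice (n : ℕ) {t : ℝ} (ht0 : 0 < t) (ht1 : t < 1) :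
    ∫⁻ m in Set.Ioc 0 (1 / t), ENNReal.ofReal (16 / 3 * m * t ^ 3 * (1 - m * t ^ 2) ^ n) =
      ENNReal.ofReal (16 / 3 / (n + 1) *
        ((∑ k ∈ Finset.range (n + 2), (1 - t) ^ k) / (n + 2) - (1 - t) ^ (n + 1))) := by
  have hn1 : (n : ℝ) + 1 ≠ 0 := by positivity
  have hn2 : (n : ℝ) + 2 ≠ 0 := by positivity
  have hgeom : (∑ k ∈ Finset.range (n + 2), (1 - t) ^ k) = (1 - (1 - t) ^ (n + 2)) / t := by
    rw [eq_div_iff ht0.ne', mul_comm, ← mul_neg_geom_sum (1 - t) (n + 2)]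
    ring
  rw [lintegral_Ioc_ofReal_eq_sub (G := fun m => 16 / 3 * t / (n + 1) *
    (-(m * (1 - m * t ^ 2) ^ (n + 1)) - (1 - m * t ^ 2) ^ (n + 2) / (t ^ 2 * (n + 2))))
    (by positivity), hgeom]
  · congr 1
    have : 1 - 1 / t * t ^ 2 = 1 - t := by field_simp
    rw [this]
    simp only [zero_mul, sub_zero, one_pow]
    field_simp
    ring
  · intro x _
    have h1 : HasDerivAt (fun m : ℝ => 1 - m * t ^ 2) (-(t ^ 2)) x :=
      (((hasDerivAt_id' x).mul_const (t ^ 2)).const_sub 1).congr_deriv (by ring)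
    refine ((((hasDerivAt_id' x).mul (h1.pow (n + 1))).neg.sub
      ((h1.pow (n + 2)).div_const (t ^ 2 * ((n : ℝ) + 2)))).const_mul
      (16 / 3 * t / ((n : ℝ) + 1))).congr_deriv ?_
    simp only [Nat.add_sub_cancel, show n + 2 - 1 = n + 1 by omega, Pi.pow_apply]
    push_cast
    field_simp
    ring
  · fun_prop
  · intro x hx
    have h2 : x * t ≤ 1 := (le_div_iff₀ ht0).mp hx.2
    have h3 : 0 ≤ 1 - x * t ^ 2 := by nlinarith [hx.1]
    have := hx.1
    positivity

/-- The harmonic sum originates here: each `(1 - t) ^ k` integrates to `1 / (k + 1)`. The last term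
contributes the `-1`. -/
lemma lintegral_geom_sum (n : ℕ) :
    ∫⁻ t in Set.Ioc (0 : ℝ) 1, ENNReal.ofReal (16 / 3 / (n + 1) *
        ((∑ k ∈ Finset.range (n + 2), (1 - t) ^ k) / (n + 2) - (1 - t) ^ (n + 1))) =
      ENNReal.ofReal (16 / 3 / ((n + 1) * (n + 2)) *
        (∑ k ∈ Finset.range (n + 2), 1 / ((k : ℝ) + 1) - 1)) := by
  have hn1 : (n : ℝ) + 1 ≠ 0 := by positivity
  have hn2 : (n : ℝ) + 2 ≠ 0 := by positivity
  rw [lintegral_Ioc_ofReal_eq_sub (G := fun t => 16 / 3 / (n + 1) *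
    ((1 - t) ^ (n + 1 + 1) / (((n + 1 : ℕ) : ℝ) + 1) -
      (∑ k ∈ Finset.range (n + 2), (1 - t) ^ (k + 1) / (k + 1)) / (n + 2))) zero_le_one]
  · congr 1
    simp only [sub_self, sub_zero, one_pow]
    rw [zero_pow (by omega)]
    simp only [zero_pow (Nat.succ_ne_zero _), zero_div, Finset.sum_const_zero]
    push_cast
    rw [show (n : ℝ) + 1 + 1 = n + 2 by ring]
    field_simp
    ring
  · intro x _
    refine (((hasDerivAt_one_sub_pow_div (n + 1) x).sub ((HasDerivAt.fun_sum
      (u := Finset.range (n + 2))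
      fun k _ => hasDerivAt_one_sub_pow_div k x).div_const ((n : ℝ) + 2))).const_mul
      (16 / 3 / ((n : ℝ) + 1))).congr_deriv ?_
    rw [Finset.sum_neg_distrib]
    ring
  · fun_prop
  · intro x hx
    have h0 : 0 ≤ 1 - x := by linarith [hx.2]
    have h1 : 1 - x ≤ 1 := by linarith [hx.1]
    refine mul_nonneg (by positivity) (sub_nonneg.mpr ?_)
    rw [le_div_iff₀ (by positivity)]
    -- On `[0, 1]` the average of the powers is at least the smallest of them, `(1 - x) ^ (n + 1)`.
    have := Finset.sum_le_sum (s := Finset.range (n + 2)) (f := fun _ => (1 - x) ^ (n + 1))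
      (g := fun k => (1 - x) ^ k)
      (fun k hk => pow_le_pow_of_le_one h0 h1 (by have := Finset.mem_range.mp hk; omega))
    rw [Finset.sum_const, Finset.card_range, nsmul_eq_mul] at this
    push_cast at this
    linarith

/-- The substitution `c = 1 + m - 2 m t` makes `2t` the extent of the chord in `v` and `1 - m t²`
the strip area. The corner range of `c` becomes, up to an endpoint, `0 < t < 1`, `m t < 1`, which is
convenient for exchanging the order of integration. -/
lemma lintegral_corner_chords_inner (n : ℕ) {m : ℝ} (hm : 0 < m) :
    ∫⁻ c in Set.Ioc |m - 1| (m + 1), stripArea c m ^ n * distIntegral (chord c m) =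
      ∫⁻ t in Set.Ioo (0 : ℝ) 1, {p : ℝ × ℝ | p.1 * p.2 < 1}.indicator (fun p =>
        ENNReal.ofReal (16 / 3 * p.1 * p.2 ^ 3 * (1 - p.1 * p.2 ^ 2) ^ n)) (m, t) := by
  have hF : ∀ c ∈ Set.Ioc |m - 1| (m + 1), stripArea c m ^ n * distIntegral (chord c m) =
      ENNReal.ofReal ((1 - m * ((1 + m - c) / m) ^ 2 / 4) ^ n * (((1 + m - c) / m) ^ 3 / 3)) := by
    rintro c ⟨h1, h2⟩
    have hc : 0 < c := (abs_nonneg _).trans_lt h1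
    obtain ⟨h3, h4⟩ := abs_lt.mp h1
    have h5 : 0 ≤ 1 + m - c := by linarith
    have h6 : 0 ≤ 1 - m * ((1 + m - c) / m) ^ 2 / 4 := by
      rw [show m * ((1 + m - c) / m) ^ 2 / 4 = (1 + m - c) ^ 2 / (4 * m) by field_simp,
        sub_nonneg, div_le_one (by positivity)]
      nlinarith
    rw [stripArea_eq_of_corner hc hm (by linarith) (by linarith) h2,
      chord_eq_of_corner hm (by linarith) (by linarith),
      distIntegral_Icc (by rw [le_div_iff₀ hm]; linarith), ← ENNReal.ofReal_pow h6,
      ← ENNReal.ofReal_mul (by positivity)]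
    congr 4
    field_simp; ring
  rw [setLIntegral_congr_fun measurableSet_Ioc hF, ← lintegral_indicator measurableSet_Ioc,
    lintegral_eq_mul_lintegral_comp_affine
      (Measurable.indicator (by fun_prop) measurableSet_Ioc)
      (show -(2 * m) ≠ 0 by linarith) (1 + m), ← lintegral_indicator measurableSet_Ioo,
    ← lintegral_const_mul' _ _ ENNReal.ofReal_ne_top, abs_neg, abs_of_pos (by positivity)]
  refine lintegral_congr fun t => ?_
  have hc : (1 + m - (1 + m + -(2 * m) * t)) / m = 2 * t := by field_simp; ring
  simp only [Set.indicator_apply, hc, Set.mem_ofPred_eq, Set.mem_Ioc, Set.mem_Ioo]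
  by_cases ht : 0 < t ∧ t < 1
  · rw [if_pos ht]
    have hiff : (|m - 1| < 1 + m + -(2 * m) * t ∧ 1 + m + -(2 * m) * t ≤ m + 1) ↔ m * t < 1 := by
      have := mul_pos hm ht.1
      rw [abs_lt]
      constructor
      · rintro ⟨⟨h1, h2⟩, h3⟩; linarith
      · intro h; refine ⟨⟨?_, ?_⟩, ?_⟩ <;> nlinarith
    by_cases h : m * t < 1
    · rw [if_pos (hiff.mpr h), if_pos h, ← ENNReal.ofReal_mul (by positivity)]
      congr 1; ring
    · rw [if_neg (fun h' => h (hiff.mp h')), if_neg h, mul_zero]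
  · rw [if_neg ht]
    by_cases ht0 : t = 0
    · simp [ht0]
    · rw [if_neg, mul_zero]
      rintro ⟨h1, h2⟩
      obtain ⟨h3, h4⟩ := abs_lt.mp h1
      apply ht
      have : 0 ≤ t := by nlinarith
      exact ⟨lt_of_le_of_ne this (Ne.symm ht0), by nlinarith⟩

/-- Lines that cut off a corner of the square. -/
lemma lintegral_corner_chords (n : ℕ) :
    ∫⁻ m in Set.Ioi (0 : ℝ), ∫⁻ c in Set.Ioc |m - 1| (m + 1),
      stripArea c m ^ n * distIntegral (chord c m) =
      ENNReal.ofReal (16 / 3 / ((n + 1) * (n + 2)) *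
        (∑ k ∈ Finset.range (n + 2), 1 / ((k : ℝ) + 1) - 1)) := by
  rw [setLIntegral_congr_fun measurableSet_Ioi
    (fun m hm => lintegral_corner_chords_inner n hm), lintegral_lintegral_swap,
    ← lintegral_geom_sum, setLIntegral_congr Ioo_ae_eq_Ioc.symm]
  · refine setLIntegral_congr_fun measurableSet_Ioo fun t ht => ?_
    rw [← lintegral_corner_slice n ht.1 ht.2, setLIntegral_congr Ioo_ae_eq_Ioc.symm,
      ← lintegral_indicator measurableSet_Ioi, ← lintegral_indicator measurableSet_Ioo]
    refine lintegral_congr fun m => ?_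
    simp only [Set.indicator_apply, Set.mem_ofPred_eq, Set.mem_Ioi, Set.mem_Ioo, ← ite_and,
      lt_div_iff₀ ht.1]
  · refine Measurable.aemeasurable ?_
    refine Measurable.indicator (by fun_prop) ?_
    exact measurableSet_lt (by fun_prop) (by fun_prop)

/-- Symmetry in the signs of `c` and `m` gives a factor 4. The two families of side-to-side lines
together contribute `16 / 3 / ((n + 1) * (n + 2))`, which exactly cancels the `-1` in the corner
term. -/
lemma lintegral_stripArea_pow_mul (n : ℕ) :
    ∫⁻ q : ℝ × ℝ, stripArea q.1 q.2 ^ n * distIntegral (chord q.1 q.2) =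
      ENNReal.ofReal (64 / 3 / ((n + 1) * (n + 2)) *
        ∑ k ∈ Finset.range (n + 2), 1 / ((k : ℝ) + 1)) := by
  have hmeas : Measurable fun q : ℝ × ℝ => stripArea q.1 q.2 ^ n * distIntegral (chord q.1 q.2) :=
    (measurable_stripArea.pow_const n).mul measurable_distIntegral_chord
  have hsplit : ∀ m ∈ Set.Ioi (0 : ℝ),
      ∫⁻ c in Set.Ioi (0 : ℝ), stripArea c m ^ n * distIntegral (chord c m) =
      (∫⁻ c in Set.Ioc 0 |m - 1|, stripArea c m ^ n * distIntegral (chord c m)) +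
      ∫⁻ c in Set.Ioc |m - 1| (m + 1), stripArea c m ^ n * distIntegral (chord c m) := by
    intro m hm
    have hm : 0 < m := hm
    have hle : |m - 1| ≤ m + 1 := abs_le.mpr ⟨by linarith, by linarith⟩
    have hzero : ∫⁻ c in Set.Ioi (m + 1), stripArea c m ^ n * distIntegral (chord c m) = 0 := by
      rw [setLIntegral_congr_fun measurableSet_Ioi (g := fun _ => 0), lintegral_zero]
      intro c hc
      beta_reduce
      rw [chord_eq_empty hm hc]
      simp [distIntegral]
    rw [← Set.Ioc_union_Ioi_eq_Ioi (show (0 : ℝ) ≤ m + 1 by linarith),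
      lintegral_union measurableSet_Ioi (Set.Ioc_disjoint_Ioi le_rfl), hzero, add_zero,
      ← Set.Ioc_union_Ioc_eq_Ioc (abs_nonneg (m - 1)) hle,
      lintegral_union measurableSet_Ioc (Set.Ioc_disjoint_Ioc_of_le le_rfl)]
  have hS : (1 : ℝ) ≤ ∑ k ∈ Finset.range (n + 2), 1 / ((k : ℝ) + 1) := by
    have := Finset.single_le_sum (f := fun k : ℕ => 1 / ((k : ℝ) + 1))
      (fun k _ => by positivity) (Finset.mem_range.mpr (show 0 < n + 2 by omega))
    simpa using this
  rw [Measure.volume_eq_prod, lintegral_prod_symm' _ hmeas, lintegral_eq_two_mul_of_even]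
  · have hc : ∀ m : ℝ, ∫⁻ c, stripArea c m ^ n * distIntegral (chord c m) =
        2 * ∫⁻ c in Set.Ioi 0, stripArea c m ^ n * distIntegral (chord c m) := fun m =>
      lintegral_eq_two_mul_of_even fun c => by
        rw [stripArea_neg_left, chord_neg_left, distIntegral_neg (measurableSet_chord _ _)]
    simp only [hc]
    rw [lintegral_const_mul' _ _ (by simp), setLIntegral_congr_fun measurableSet_Ioi hsplit,
      lintegral_add_right', lintegral_corner_chords,
      ← Set.Ioc_union_Ioi_eq_Ioi (zero_le_one (α := ℝ)),
      lintegral_union measurableSet_Ioi (Set.Ioc_disjoint_Ioi le_rfl), lintegral_vertical_chords,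
      lintegral_horizontal_chords, ← ENNReal.ofReal_add (by positivity) (by positivity),
      ← ENNReal.ofReal_add (by positivity) (mul_nonneg (by positivity) (by linarith)),
      show (2 : ENNReal) = ENNReal.ofReal 2 by norm_num, ← ENNReal.ofReal_mul (by norm_num),
      ← ENNReal.ofReal_mul (by norm_num)]
    · congr 1; ring
    · refine AEMeasurable.congr (f := fun m => ∫⁻ t in Set.Ioo (0 : ℝ) 1,
        {p : ℝ × ℝ | p.1 * p.2 < 1}.indicator (fun p =>
        ENNReal.ofReal (16 / 3 * p.1 * p.2 ^ 3 * (1 - p.1 * p.2 ^ 2) ^ n)) (m, t)) ?_ ?_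
      · refine (Measurable.lintegral_prod_right' (Measurable.indicator (by fun_prop) ?_)).aemeasurable
        exact measurableSet_lt (by fun_prop) (by fun_prop)
      · filter_upwards [ae_restrict_mem measurableSet_Ioi] with m hm
        exact (lintegral_corner_chords_inner n hm).symm
  · intro m
    refine lintegral_congr fun c => ?_
    rw [stripArea_neg_right, chord_neg_right, distIntegral_neg (measurableSet_chord _ _)]

/-! ### The probability that a uniform point misses the hull -/

lemma continuous_cross : Continuous fun p : (ℝ × ℝ) × (ℝ × ℝ) => cross p.1 p.2 := by
  unfold cross; fun_prop

lemma measurable_cross {α : Type*} [MeasurableSpace α] {f g : α → ℝ × ℝ} (hf : Measurable f)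
    (hg : Measurable g) : Measurable fun a => cross (f a) (g a) :=
  continuous_cross.measurable.comp (hf.prodMk hg)

lemma measurable_orient : Measurable fun p : (ℝ × ℝ) × (ℝ × ℝ) => orient p.1 p.2 :=
  Measurable.ite (measurableSet_lt measurable_const continuous_cross.measurable)
    (by fun_prop) (by fun_prop)

lemma measurableSet_openStrip :
    MeasurableSet {p : ((ℝ × ℝ) × (ℝ × ℝ)) × (ℝ × ℝ) | p.2 ∈ openStrip p.1.1 p.1.2} :=
  measurableSet_lt (measurable_cross (by fun_prop) (by fun_prop)).abs
    (measurable_cross (by fun_prop) (by fun_prop)).abs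

lemma measurableSet_closedStrip :
    MeasurableSet {p : ((ℝ × ℝ) × (ℝ × ℝ)) × (ℝ × ℝ) | p.2 ∈ closedStrip p.1.1 p.1.2} :=
  measurableSet_le (measurable_cross (by fun_prop) (by fun_prop)).abs
    (measurable_cross (by fun_prop) (by fun_prop)).abs

lemma cross_comm (z y : ℝ × ℝ) : cross y z = -cross z y := by
  simp only [cross]; ring

lemma cross_neg_right (z y : ℝ × ℝ) : cross z (-y) = -cross z y := by
  simp only [cross, Prod.fst_neg, Prod.snd_neg]; ring

lemma openStrip_comm (z y : ℝ × ℝ) : openStrip y z = openStrip z y := by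
  ext w
  simp only [openStrip, Set.mem_ofPred_eq]
  rw [cross_comm z y, abs_neg, ← neg_sub, cross_neg_right, abs_neg]

lemma closedStrip_comm (z y : ℝ × ℝ) : closedStrip y z = closedStrip z y := by
  ext w
  simp only [closedStrip, Set.mem_ofPred_eq]
  rw [cross_comm z y, abs_neg, ← neg_sub, cross_neg_right, abs_neg]

lemma lintegral_strip_pow_eval {S : ℝ × ℝ → ℝ × ℝ → Set (ℝ × ℝ)} (n : ℕ)
    (hS : MeasurableSet {p : ((ℝ × ℝ) × (ℝ × ℝ)) × (ℝ × ℝ) | p.2 ∈ S p.1.1 p.1.2})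
    (hline : ∀ c m v₁ v₂ : ℝ, v₁ ≠ v₂ →
      squareUnif (S (c + m * v₁, v₁) (c + m * v₂, v₂)) = stripArea c m) :
    ∫⁻ z, ∫⁻ y, squareUnif (S z y) ^ n ∂squareUnif ∂squareUnif =
      ENNReal.ofReal (4 / 3 / ((n + 1) * (n + 2)) *
        ∑ k ∈ Finset.range (n + 2), 1 / ((k : ℝ) + 1)) := by
  rw [lintegral_strip_pow n hS hline, lintegral_stripArea_pow_mul,
    show (4 : ENNReal)⁻¹ = ENNReal.ofReal 4⁻¹ by
      rw [ENNReal.ofReal_inv_of_pos (by norm_num)]; norm_num,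
    ← ENNReal.ofReal_mul (by norm_num), ← ENNReal.ofReal_mul (by norm_num)]
  congr 1; ring

lemma lintegral_comp_neg_squareUnif (f : ℝ × ℝ → ENNReal) :
    ∫⁻ z, f (-z) ∂squareUnif = ∫⁻ z, f z ∂squareUnif := by
  rw [lintegral_squareUnif, lintegral_squareUnif]
  congr 1
  rw [← lintegral_neg_eq_self]
  refine lintegral_congr fun z => ?_
  rw [neg_neg]
  congr 1
  have : -z ∈ square ↔ z ∈ square := by
    simp only [square, Set.mem_prod, Set.mem_Icc, Prod.fst_neg, Prod.snd_neg]
    constructor <;> rintro ⟨⟨h1, h2⟩, h3, h4⟩ <;> refine ⟨⟨?_, ?_⟩, ?_, ?_⟩ <;> linarith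
  by_cases hz : z ∈ square
  · rw [Set.indicator_of_mem hz, Set.indicator_of_mem (this.mpr hz), Pi.one_apply, Pi.one_apply]
  · rw [Set.indicator_of_notMem hz, Set.indicator_of_notMem (fun h => hz (this.mp h))]

/-- For a symmetric integrand, orienting the second point does not change the integral. -/
lemma lintegral_orient {g : ℝ × ℝ → ℝ × ℝ → ENNReal} (hg : Measurable (Function.uncurry g))
    (hsymm : ∀ z y, g y z = g z y) :
    ∫⁻ z, ∫⁻ y, g z (orient z y) ∂squareUnif ∂squareUnif =
      ∫⁻ z, ∫⁻ y, g z y ∂squareUnif ∂squareUnif := by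
  set A : ℝ × ℝ → ℝ × ℝ → ENNReal := fun z y => if 0 < cross z y then g z y else 0 with hA
  set B : ℝ × ℝ → ℝ × ℝ → ENNReal := fun z y => if 0 < cross z y then 0 else g z y with hB
  set C : ℝ × ℝ → ℝ × ℝ → ENNReal := fun z y => if 0 < cross z y then g z (-y) else 0 with hC
  have hpos : MeasurableSet {p : (ℝ × ℝ) × (ℝ × ℝ) | 0 < cross p.1 p.2} :=
    measurableSet_lt measurable_const continuous_cross.measurable
  have hAm : Measurable (Function.uncurry A) := Measurable.ite hpos hg measurable_const
  have hBm : Measurable (Function.uncurry B) := Measurable.ite hpos measurable_const hg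
  -- Replacing `y` by `-y` moves the flipped part to the pairs with negative determinant; exchanging
  -- `z` and `y` makes the determinant positive again, and `g` is symmetric.
  have hAC : ∫⁻ z, ∫⁻ y, C z y ∂squareUnif ∂squareUnif =
      ∫⁻ z, ∫⁻ y, A z y ∂squareUnif ∂squareUnif := by
    calc _ = ∫⁻ z, ∫⁻ y, C z (-y) ∂squareUnif ∂squareUnif :=
          lintegral_congr fun z => (lintegral_comp_neg_squareUnif _).symm
      _ = ∫⁻ z, ∫⁻ y, A y z ∂squareUnif ∂squareUnif := by
          refine lintegral_congr fun z => lintegral_congr fun y => ?_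
          simp only [hC, hA, cross_neg_right, neg_neg, cross_comm z y, hsymm]
      _ = _ := lintegral_lintegral_swap (hAm.comp measurable_swap).aemeasurable
  have e1 : ∀ z y, g z (orient z y) = C z y + B z y := by
    intro z y; simp only [hC, hB, orient]; split_ifs <;> simp
  have e2 : ∀ z y, g z y = A z y + B z y := by
    intro z y; simp only [hA, hB]; split_ifs <;> simp
  have hsum : ∀ D : ℝ × ℝ → ℝ × ℝ → ENNReal,
      ∫⁻ z, ∫⁻ y, (D z y + B z y) ∂squareUnif ∂squareUnif =
      ∫⁻ z, ∫⁻ y, D z y ∂squareUnif ∂squareUnif + ∫⁻ z, ∫⁻ y, B z y ∂squareUnif ∂squareUnif := by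
    intro D
    rw [← lintegral_add_right _ hBm.lintegral_prod_right]
    refine lintegral_congr fun z => lintegral_add_right _ ?_
    exact hBm.comp (measurable_const.prodMk measurable_id)
  simp_rw [e1]
  rw [hsum, hAC, ← hsum]
  simp_rw [← e2]

lemma measurableSet_forall_ne {α : Type*} [MeasurableSpace α] {N : ℕ} {S : α → Set α}
    (hS : MeasurableSet {p : α × α | p.2 ∈ S p.1}) (i : Fin N) :
    MeasurableSet {y : Fin N → α | ∀ j, j ≠ i → y j ∈ S (y i)} := by
  simp only [Set.ofPred_forall]
  refine MeasurableSet.iInter fun j => MeasurableSet.iInter fun _ => ?_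
  exact hS.preimage (f := fun y : Fin N → α => (y i, y j)) (by fun_prop)

/-- Given the `i`-th point, the other `n` are independent and each lies in `S (y i)` with the same
probability. -/
lemma pi_forall_ne_mem {α : Type*} [MeasurableSpace α] (ν : Measure α) [SigmaFinite ν] {n : ℕ}
    {S : α → Set α} (hS : MeasurableSet {p : α × α | p.2 ∈ S p.1}) (i : Fin (n + 1)) :
    Measure.pi (fun _ : Fin (n + 1) => ν) {y | ∀ j, j ≠ i → y j ∈ S (y i)} =
      ∫⁻ x, ν (S x) ^ n ∂ν := by
  have hmp := measurePreserving_piFinSuccAbove (fun _ : Fin (n + 1) => ν) i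
  have hT : MeasurableSet {p : α × (Fin n → α) | ∀ j, p.2 j ∈ S p.1} := by
    simp only [Set.ofPred_forall]
    refine MeasurableSet.iInter fun j => ?_
    exact hS.preimage (f := fun p : α × (Fin n → α) => (p.1, p.2 j)) (by fun_prop)
  have hpre : {y : Fin (n + 1) → α | ∀ j, j ≠ i → y j ∈ S (y i)} =
      MeasurableEquiv.piFinSuccAbove (fun _ => α) i ⁻¹'
        {p : α × (Fin n → α) | ∀ j, p.2 j ∈ S p.1} := by
    ext y
    change (∀ j, j ≠ i → y j ∈ S (y i)) ↔ ∀ j, y (i.succAbove j) ∈ S (y i)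
    constructor
    · intro h j; exact h _ (Fin.succAbove_ne i j)
    · intro h j hj
      obtain ⟨k, rfl⟩ := Fin.exists_succAbove_eq hj
      exact h k
  rw [hpre, hmp.measure_preimage hT.nullMeasurableSet, Measure.prod_apply hT]
  refine lintegral_congr fun x => ?_
  have : Prod.mk x ⁻¹' {p : α × (Fin n → α) | ∀ j, p.2 j ∈ S p.1} =
      Set.univ.pi fun _ => S x := by
    ext y
    simp only [Set.mem_preimage, Set.mem_ofPred_eq, Set.mem_univ_pi]
  rw [this, Measure.pi_pi, Finset.prod_const, Finset.card_univ, Fintype.card_fin]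

/-- The probability that a uniform point misses the symmetric hull of `n + 1` others. -/
lemma lintegral_compl_planarSymmHull {n : ℕ} (hn : 1 ≤ n) :
    ∫⁻ y, squareUnif (planarSymmHull y)ᶜ ∂(Measure.pi fun _ : Fin (n + 1) => squareUnif) =
      ENNReal.ofReal (4 / 3 / (n + 2) * ∑ k ∈ Finset.range (n + 2), 1 / ((k : ℝ) + 1)) := by
  set μ := Measure.pi fun _ : Fin (n + 1) => squareUnif with hμ
  have hB := (isOpen_notMem_planarSymmHull n).measurableSet
  have hswap : ∫⁻ y, squareUnif (planarSymmHull y)ᶜ ∂μ =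
      ∫⁻ z, μ {y | z ∉ planarSymmHull y} ∂squareUnif :=
    (Measure.prod_apply (μ := μ) (ν := squareUnif) hB).symm.trans
      (Measure.prod_apply_symm (μ := μ) (ν := squareUnif) hB)
  have hSo : ∀ z, MeasurableSet {p : (ℝ × ℝ) × (ℝ × ℝ) | p.2 ∈ openStrip z (orient z p.1)} :=
    fun z => measurableSet_openStrip.preimage
      (f := fun p : (ℝ × ℝ) × (ℝ × ℝ) => ((z, orient z p.1), p.2))
      ((measurable_const.prodMk (measurable_orient.comp
        (measurable_const.prodMk measurable_fst))).prodMk measurable_snd)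
  have hSc : ∀ z, MeasurableSet {p : (ℝ × ℝ) × (ℝ × ℝ) | p.2 ∈ closedStrip z (orient z p.1)} :=
    fun z => measurableSet_closedStrip.preimage
      (f := fun p : (ℝ × ℝ) × (ℝ × ℝ) => ((z, orient z p.1), p.2))
      ((measurable_const.prodMk (measurable_orient.comp
        (measurable_const.prodMk measurable_fst))).prodMk measurable_snd)
  have hfinal : ENNReal.ofReal (4 / 3 / (n + 2) * ∑ k ∈ Finset.range (n + 2), 1 / ((k : ℝ) + 1)) =
      ((n + 1 : ℕ) : ENNReal) * ENNReal.ofReal (4 / 3 / ((n + 1) * (n + 2)) *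
        ∑ k ∈ Finset.range (n + 2), 1 / ((k : ℝ) + 1)) := by
    rw [← ENNReal.ofReal_natCast, ← ENNReal.ofReal_mul (by positivity)]
    congr 1
    push_cast
    field_simp
  rw [hswap, hfinal]
  refine le_antisymm ?_ ?_
  -- Upper bound: the closed-strip events cover the event of missing, so a union bound suffices.
  · rw [← lintegral_strip_pow_eval n measurableSet_closedStrip
      (fun c m v₁ v₂ h => by rw [closedStrip_line h, stripArea]),
      ← lintegral_orient (g := fun z y => squareUnif (closedStrip z y) ^ n)
        ((measurable_measure_prodMk_left measurableSet_closedStrip).pow_const n)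
        (fun z y => by rw [closedStrip_comm]),
      ← lintegral_const_mul' _ _ (ENNReal.natCast_ne_top _)]
    refine lintegral_mono fun z => ?_
    calc μ {y | z ∉ planarSymmHull y}
        ≤ μ (⋃ i, {y | ∀ j, j ≠ i → y j ∈ closedStrip z (orient z (y i))}) := by
          refine measure_mono fun y hy => ?_
          obtain ⟨i, hi⟩ := exists_closedStrip_of_notMem_planarSymmHull hy
          exact Set.mem_iUnion.mpr ⟨i, fun j _ => hi j⟩
      _ ≤ ∑ i, μ {y | ∀ j, j ≠ i → y j ∈ closedStrip z (orient z (y i))} :=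
          measure_iUnion_fintype_le _ _
      _ = _ := by
          simp_rw [hμ, pi_forall_ne_mem squareUnif
            (S := fun x => closedStrip z (orient z x)) (hSc z)]
          rw [Finset.sum_const, Finset.card_univ, Fintype.card_fin, nsmul_eq_mul]
  -- Lower bound: the open-strip events are disjoint and contained in the event of missing.
  · rw [← lintegral_strip_pow_eval n measurableSet_openStrip
      (fun c m v₁ v₂ h => by rw [openStrip_line h, squareUnif_strip_lt]),
      ← lintegral_orient (g := fun z y => squareUnif (openStrip z y) ^ n)
        ((measurable_measure_prodMk_left measurableSet_openStrip).pow_const n)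
        (fun z y => by rw [openStrip_comm]),
      ← lintegral_const_mul' _ _ (ENNReal.natCast_ne_top _)]
    refine lintegral_mono fun z => ?_
    -- A second point lying in the open strip shows that the strip is nonempty, which forces `cross
    -- z (y i) ≠ 0`. This is where `1 ≤ n` enters.
    have hne : ∀ i : Fin (n + 1), ∃ j, j ≠ i := fun i =>
      ⟨i.succAbove ⟨0, hn⟩, Fin.succAbove_ne _ _⟩
    calc _ = ∑ i, μ {y | ∀ j, j ≠ i → y j ∈ openStrip z (orient z (y i))} := by
          simp_rw [hμ, pi_forall_ne_mem squareUnif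
            (S := fun x => openStrip z (orient z x)) (hSo z)]
          rw [Finset.sum_const, Finset.card_univ, Fintype.card_fin, nsmul_eq_mul]
      _ = μ (⋃ i, {y | ∀ j, j ≠ i → y j ∈ openStrip z (orient z (y i))}) := by
          rw [measure_iUnion _ fun i => measurableSet_forall_ne
            (S := fun x => openStrip z (orient z x)) (hSo z) i, tsum_fintype]
          intro i k hik
          refine Set.disjoint_left.mpr fun y hi hk => ?_
          exact notMem_openStrip_orient_of_mem (hi k hik.symm) (hk i hik)
      _ ≤ μ {y | z ∉ planarSymmHull y} := by
          refine measure_mono fun y hy => ?_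
          obtain ⟨i, hi⟩ := Set.mem_iUnion.mp hy
          refine notMem_planarSymmHull_of_openStrip (i := i) (fun h0 => ?_) hi
          obtain ⟨j, hj⟩ := hne i
          have h1 : |cross (y j) (orient z (y i) - z)| < |cross z (orient z (y i))| := hi j hj
          have h2 : cross z (orient z (y i)) = 0 := by
            rcases orient_eq_or z (y i) with h | h <;> rw [h]
            · exact h0
            · rw [cross_neg_right, h0, neg_zero]
          rw [h2, abs_zero] at h1
          exact absurd h1 (not_lt.mpr (abs_nonneg _))

lemma measurable_squareUnif_planarSymmHull (n : ℕ) :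
    Measurable fun y : Fin (n + 1) → ℝ × ℝ => squareUnif (planarSymmHull y) := by
  have h := (isOpen_notMem_planarSymmHull n).measurableSet.compl
  simp only [Set.compl_ofPred, not_not] at h
  exact measurable_measure_prodMk_left h

lemma measurableSet_planarSymmHull {N : ℕ} (y : Fin N → ℝ × ℝ) :
    MeasurableSet (planarSymmHull y) :=
  (((Set.finite_range y).union (Set.finite_range _)).isCompact_convexHull ℝ).isClosed.measurableSet

/-- The expected normalized area of the symmetric hull of uniform points of the square. -/
lemma integral_squareUnif_planarSymmHull {n : ℕ} (hn : 1 ≤ n) :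
    ∫ y, (squareUnif (planarSymmHull y)).toReal
        ∂(Measure.pi fun _ : Fin (n + 1) => squareUnif) =
      1 - 4 / 3 / (n + 2) * ∑ k ∈ Finset.range (n + 2), 1 / ((k : ℝ) + 1) := by
  have hsum : ∫⁻ y, squareUnif (planarSymmHull y) ∂(Measure.pi fun _ : Fin (n + 1) => squareUnif) +
      ENNReal.ofReal (4 / 3 / (n + 2) * ∑ k ∈ Finset.range (n + 2), 1 / ((k : ℝ) + 1)) = 1 := by
    rw [← lintegral_compl_planarSymmHull hn,
      ← lintegral_add_left (measurable_squareUnif_planarSymmHull n)]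
    simp_rw [measure_add_measure_compl (measurableSet_planarSymmHull _), measure_univ]
    simp
  have h1 : ∫⁻ y, squareUnif (planarSymmHull y)
      ∂(Measure.pi fun _ : Fin (n + 1) => squareUnif) ≠ ⊤ := fun h => by simp [h] at hsum
  rw [integral_toReal (measurable_squareUnif_planarSymmHull n).aemeasurable
    (Filter.Eventually.of_forall fun y => measure_lt_top _ _)]
  have h2 := congrArg ENNReal.toReal hsum
  rw [ENNReal.toReal_add h1 ENNReal.ofReal_ne_top, ENNReal.toReal_ofReal (by positivity),
    ENNReal.toReal_one] at h2
  linarith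

/-! ### Reduction of the parallelogram to the square -/

lemma convex_square : Convex ℝ square := (convex_Icc _ _).prod (convex_Icc _ _)

lemma neg_mem_square {z : ℝ × ℝ} (hz : z ∈ square) : -z ∈ square := by
  simp only [square, Set.mem_prod, Set.mem_Icc, Prod.fst_neg, Prod.snd_neg] at *
  refine ⟨⟨?_, ?_⟩, ?_, ?_⟩ <;> linarith [hz.1.1, hz.1.2, hz.2.1, hz.2.2]

lemma planarSymmHull_subset_square {N : ℕ} {y : Fin N → ℝ × ℝ} (hy : ∀ i, y i ∈ square) :
    planarSymmHull y ⊆ square := by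
  refine convexHull_min ?_ convex_square
  rintro _ (⟨i, rfl⟩ | ⟨i, rfl⟩)
  · exact hy i
  · exact neg_mem_square (hy i)

/-- Almost surely all points lie in the square, hence so does their symmetric hull, and its uniform
measure is its area over 4. -/
lemma ae_volume_planarSymmHull (N : ℕ) :
    (fun y : Fin N → ℝ × ℝ => (volume (planarSymmHull y)).toReal / 4) =ᵐ[Measure.pi fun _ =>
      squareUnif] fun y => (squareUnif (planarSymmHull y)).toReal := by
  have hsq : ∀ᵐ z ∂squareUnif, z ∈ square := ae_cond_mem measurableSet_square
  have hall : ∀ᵐ y : Fin N → ℝ × ℝ ∂(Measure.pi fun _ => squareUnif), ∀ i, y i ∈ square :=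
    ae_all_iff.mpr fun i => (Measure.tendsto_eval_ae_ae (i := i)).eventually hsq
  filter_upwards [hall] with y hy
  rw [squareUnif_apply (measurableSet_planarSymmHull y),
    Set.inter_eq_left.mpr (planarSymmHull_subset_square hy), ENNReal.toReal_mul]
  simp; ring

/-- A centrally symmetric parallelogram is a linear image of the square. -/
lemma IsParallelogram.exists_image_square {P : Set (EuclideanSpace ℝ (Fin 2))}
    (hP : IsParallelogram P) (hsymm : -P = P) :
    ∃ T : (ℝ × ℝ) ≃L[ℝ] EuclideanSpace ℝ (Fin 2), P = T '' square := by
  obtain ⟨c, a, b, hab, hPeq⟩ := hP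
  rw [LinearIndependent.pair_iff] at hab
  let f : (ℝ × ℝ) →ₗ[ℝ] EuclideanSpace ℝ (Fin 2) :=
    (LinearMap.fst ℝ ℝ ℝ).smulRight ((1 / 2 : ℝ) • a) +
      (LinearMap.snd ℝ ℝ ℝ).smulRight ((1 / 2 : ℝ) • b)
  have hf : ∀ p : ℝ × ℝ, f p = (p.1 / 2) • a + (p.2 / 2) • b := by
    intro p
    simp only [f, LinearMap.add_apply, LinearMap.smulRight_apply, LinearMap.fst_apply,
      LinearMap.snd_apply, smul_smul]
    congr 2 <;> ring
  have hinj : Function.Injective f := by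
    rw [injective_iff_map_eq_zero]
    intro p hp
    rw [hf] at hp
    obtain ⟨h1, h2⟩ := hab _ _ hp
    ext <;> simp <;> linarith
  let T := (LinearEquiv.ofInjectiveOfFinrankEq f hinj (by simp)).toContinuousLinearEquiv
  have hT : ∀ p, T p = (p.1 / 2) • a + (p.2 / 2) • b := hf
  obtain ⟨⟨α, β⟩, hαβ⟩ := T.surjective (c + (1 / 2 : ℝ) • a + (1 / 2 : ℝ) • b)
  have hc : c = T (α - 1, β - 1) := by
    have : c = T (α, β) - T (1, 1) := by
      rw [hαβ, hT]; simp only; abel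
    rw [this, ← map_sub]; rfl
  have hmem : ∀ p : ℝ × ℝ, T p ∈ P ↔ |p.1 - α| ≤ 1 ∧ |p.2 - β| ≤ 1 := by
    intro p
    have key : ∀ s t : ℝ, c + s • a + t • b = T (α - 1 + 2 * s, β - 1 + 2 * t) := by
      intro s t
      have : s • a + t • b = T (2 * s, 2 * t) := by
        rw [hT]; simp
      rw [hc, add_assoc, this, ← map_add]; rfl
    rw [hPeq, Set.mem_ofPred_eq, abs_le, abs_le]
    constructor
    · rintro ⟨s, ⟨hs0, hs1⟩, t, ⟨ht0, ht1⟩, h⟩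
      rw [key] at h
      have := T.injective h
      rw [this]
      refine ⟨⟨?_, ?_⟩, ?_, ?_⟩ <;> simp only <;> linarith
    · rintro ⟨⟨h1, h2⟩, h3, h4⟩
      refine ⟨(p.1 - α + 1) / 2, ⟨by linarith, by linarith⟩, (p.2 - β + 1) / 2,
        ⟨by linarith, by linarith⟩, ?_⟩
      rw [key]
      congr 1
      ext <;> simp only <;> ring
  have hneg : ∀ p : ℝ × ℝ, T p ∈ P → T (-p) ∈ P := by
    intro p hp
    rw [map_neg, ← hsymm]
    exact Set.neg_mem_neg.mpr hp
  -- `(α, β)` is the centre in the coordinates of `T`. Reflecting two opposite corners back into `P`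
  -- forces it to vanish.
  have h1 := (hmem _).mp (hneg (α + 1, β + 1) ((hmem _).mpr (by simp)))
  have h2 := (hmem _).mp (hneg (α - 1, β - 1) ((hmem _).mpr (by simp)))
  simp only [Prod.fst_neg, Prod.snd_neg, abs_le] at h1 h2
  have hα : α = 0 := by linarith [h1.1.1, h2.1.2]
  have hβ : β = 0 := by linarith [h1.2.1, h2.2.2]
  refine ⟨T, ?_⟩
  ext x
  obtain ⟨p, rfl⟩ := T.surjective x
  rw [hmem, hα, hβ, T.injective.mem_set_image, sub_zero, sub_zero, abs_le, abs_le]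
  rfl

/-- Uniqueness of Haar measure suffices: only ratios of areas occur later, so the scale factor (a
determinant) need not be computed. -/
lemma exists_volume_image_eq (T : (ℝ × ℝ) ≃L[ℝ] EuclideanSpace ℝ (Fin 2)) :
    ∃ κ : ENNReal, κ ≠ 0 ∧ κ ≠ ⊤ ∧ ∀ s, volume (T '' s) = κ * volume s := by
  let ν := Measure.map T (volume : Measure (ℝ × ℝ))
  have hν : ν.IsAddHaarMeasure := T.isAddHaarMeasure_map volume
  have h := Measure.isAddLeftInvariant_eq_smul (volume : Measure (EuclideanSpace ℝ (Fin 2))) ν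
  refine ⟨Measure.addHaarScalarFactor volume ν, ?_, ENNReal.coe_ne_top, fun s => ?_⟩
  · intro h0
    rw [ENNReal.coe_eq_zero] at h0
    rw [h0, zero_smul] at h
    exact NeZero.ne _ h
  · conv_lhs => rw [h]
    rw [Measure.smul_apply]
    have : ν (T '' s) = volume s := by
      change Measure.map T.toHomeomorph.toMeasurableEquiv volume (T '' s) = _
      rw [MeasurableEquiv.map_apply]
      congr 1
      exact Set.preimage_image_eq s T.injective
    rw [this]
    rfl

lemma symmConvexHull_image {N : ℕ} (T : (ℝ × ℝ) ≃L[ℝ] EuclideanSpace ℝ (Fin 2))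
    (y : Fin N → ℝ × ℝ) : symmConvexHull (fun i => T (y i)) = T '' planarSymmHull y := by
  have h := (T.toLinearEquiv : (ℝ × ℝ) →ₗ[ℝ] EuclideanSpace ℝ (Fin 2)).image_convexHull
    (Set.range y ∪ Set.range (fun i => -y i))
  refine Eq.trans ?_ h.symm
  rw [symmConvexHull, Set.image_union, ← Set.range_comp, ← Set.range_comp]
  congr 3
  ext1 i
  exact (map_neg T (y i)).symm

lemma normalizedSymmVolume_image {N : ℕ} (T : (ℝ × ℝ) ≃L[ℝ] EuclideanSpace ℝ (Fin 2))
    (x : Fin N → EuclideanSpace ℝ (Fin 2)) :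
    normalizedSymmVolume (T '' square) x =
      (volume (planarSymmHull fun i => T.symm (x i))).toReal / 4 := by
  obtain ⟨κ, h0, htop, hκ⟩ := exists_volume_image_eq T
  have hx : x = fun i => T (T.symm (x i)) := by simp
  have hκ0 : κ.toReal ≠ 0 := ENNReal.toReal_ne_zero.mpr ⟨h0, htop⟩
  conv_lhs => rw [hx]
  rw [normalizedSymmVolume, symmConvexHull_image, hκ, hκ, volume_square, ENNReal.toReal_mul,
    ENNReal.toReal_mul, mul_div_mul_left _ _ hκ0]
  norm_num

lemma map_symm_cond_image_square (T : (ℝ × ℝ) ≃L[ℝ] EuclideanSpace ℝ (Fin 2)) :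
    Measure.map T.symm (ProbabilityTheory.cond volume (T '' square)) = squareUnif := by
  obtain ⟨κ, h0, htop, hκ⟩ := exists_volume_image_eq T
  have hm : MeasurableSet (T '' square) :=
    T.toHomeomorph.toMeasurableEquiv.measurableSet_image.mpr measurableSet_square
  ext s hs
  rw [Measure.map_apply T.symm.continuous.measurable hs, cond_apply hm, squareUnif,
    cond_apply measurableSet_square]
  have : T '' square ∩ T.symm ⁻¹' s = T '' (square ∩ s) := by
    rw [Set.image_inter T.injective]
    congr 1
    exact (T.toEquiv.image_eq_preimage_symm s).symm
  rw [this, hκ, hκ, ENNReal.mul_inv (Or.inl h0) (Or.inl htop), mul_mul_mul_comm,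
    ENNReal.inv_mul_cancel h0 htop, one_mul]

theorem mainTheorem5
    (P : Set (EuclideanSpace ℝ (Fin 2))) (hP : IsParallelogram P) (hsymm : -P = P)
    (N : ℕ) (hN : 2 ≤ N)
    {Ω : Type*} [MeasurableSpace Ω] (μ : Measure Ω) [IsProbabilityMeasure μ]
    (X : Fin N → Ω → EuclideanSpace ℝ (Fin 2))
    (hindep : iIndepFun X μ)
    (hunif : ∀ i, pdf.IsUniform (X i) P μ volume) :
    Integrable (fun ω => normalizedSymmVolume P (fun i => X i ω)) μ ∧
      ∫ ω, normalizedSymmVolume P (fun i => X i ω) ∂μ =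
        1 - 4 / (3 * ((N : ℝ) + 1)) * ∑ k ∈ Finset.Icc 1 (N + 1), 1 / (k : ℝ) := by
  obtain ⟨T, rfl⟩ := hP.exists_image_square hsymm
  obtain ⟨n, rfl⟩ : ∃ n, N = n + 1 := ⟨N - 1, by omega⟩
  obtain ⟨κ, h0, htop, hκ⟩ := exists_volume_image_eq T
  -- Uniformity yields measurability because the conditional measure is nonzero, whereas the
  -- push-forward along a map that is not a.e. measurable is zero by convention; hence the need for
  -- positive finite area.
  have hX : ∀ i, AEMeasurable (X i) μ := fun i => (hunif i).aemeasurable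
    (by rw [hκ, volume_square]; exact mul_ne_zero h0 (by norm_num))
    (by rw [hκ, volume_square]; exact ENNReal.mul_ne_top htop (by norm_num))
  have hTm : Measurable T.symm := T.symm.continuous.measurable
  have hY : ∀ i, AEMeasurable (fun ω => T.symm (X i ω)) μ := fun i => hTm.comp_aemeasurable (hX i)
  have hlaw : Measure.map (fun ω i => T.symm (X i ω)) μ = Measure.pi fun _ => squareUnif := by
    rw [iIndepFun.map_fun_eq_pi_map hY (hindep.comp (fun _ => T.symm) fun _ => hTm)]
    congr 1
    ext1 i
    change Measure.map (T.symm ∘ X i) μ = squareUnif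
    rw [← AEMeasurable.map_map_of_aemeasurable hTm.aemeasurable (hX i), hunif i,
      map_symm_cond_image_square]
  have hYm : AEMeasurable (fun ω i => T.symm (X i ω)) μ := aemeasurable_pi_lambda _ hY
  simp_rw [normalizedSymmVolume_image]
  have hint : Integrable (fun y : Fin (n + 1) → ℝ × ℝ => (volume (planarSymmHull y)).toReal / 4)
      (Measure.map (fun ω i => T.symm (X i ω)) μ) := by
    rw [hlaw]
    refine Integrable.congr ?_ (ae_volume_planarSymmHull (n + 1)).symm
    refine Integrable.of_bound (C := 1)
      (measurable_squareUnif_planarSymmHull n).ennreal_toReal.aestronglyMeasurable ?_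
    refine Filter.Eventually.of_forall fun y => ?_
    rw [Real.norm_of_nonneg ENNReal.toReal_nonneg]
    exact ENNReal.toReal_le_of_le_ofReal zero_le_one (by simpa using prob_le_one)
  refine ⟨hint.comp_aemeasurable hYm, ?_⟩
  rw [← integral_map (f := fun y : Fin (n + 1) → ℝ × ℝ => (volume (planarSymmHull y)).toReal / 4)
    hYm hint.aestronglyMeasurable, hlaw, integral_congr_ae (ae_volume_planarSymmHull (n + 1)),
    integral_squareUnif_planarSymmHull (by omega)]
  have hsum : ∑ k ∈ Finset.Icc 1 (n + 1 + 1), 1 / (k : ℝ) =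
      ∑ k ∈ Finset.range (n + 2), 1 / ((k : ℝ) + 1) := by
    rw [Finset.range_eq_Ico, ← Finset.Ico_add_one_right_eq_Icc,
      ← Finset.sum_Ico_add' (fun k : ℕ => 1 / (k : ℝ)) 0 (n + 2) 1]
    exact Finset.sum_congr rfl fun k _ => by push_cast; rfl
  rw [hsum, show ((n + 1 : ℕ) : ℝ) + 1 = n + 2 by push_cast; ring, div_div]
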